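/- Let $\alpha\in\{4,8\}$ and let $\beta$ be the other element of $\{4,8\}$. On $\mathbb{R}^2$ let $d_4(x,y)=|x_1-y_1|+|x_2-y_2|$ and $d_8(x,y)=\max\{|x_1-y_1|,|x_2-y_2|\}$, and for $S\subseteq\mathbb{Z}^2$ put $d_\alpha(x,S)=\inf_{z\in S}d_\alpha(x,z)$. Two points of $\mathbb{Z}^2$ are $d_\alpha$-adjacent if their $d_\alpha$-distance is $1$. Let $T\subset\mathbb{Z}^2$ be an $\alpha$-connected component, that is, a finite nonempty set any two points of which are joined by a sequence of points of $T$ in which consecutive points are $d_\alpha$-adjacent. Let $P_\alpha(T)$ be the set of points of $\mathbb{Z}^2\setminus T$ that are $d_\alpha$-adjacent to a point of $T$. Let $G_\alpha(T)$ be the graph with vertex set $\mathbb{Z}^2$ whose edges join any two $d_\alpha$-adjacent points of $\mathbb{Z}^2\setminus P_\alpha(T)$ and any two $d_\beta$-adjacent points of $P_\alpha(T)$. Let $E_\alpha(T)$ be the unique infinite connected component of $G_\alpha(T)$, and let $P_\alpha^{ext}(T)$ be the subgraph of $G_\alpha(T)$ induced by the points of $P_\alpha(T)$ that are $d_\alpha$-adjacent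 to a point of $E_\alpha(T)$. Embed $P_\alpha^{ext}(T)$ in $\mathbb{R}^2$ by drawing its edges as straight segments (this gives a simple closed polygon). Let $V_\alpha(T)\subset\mathbb{R}^2$ be the open polygonal region bounded by this polygon, that is, the set of the points off the polygon that lie in a bounded connected component of its complement, and let $Z_\alpha(T)=V_\alpha(T)\cap\mathbb{Z}^2$. Then $$V_\alpha(T)=\{x\in\mathbb{R}^2 : d_\alpha(x,Z_\alpha(T))<d_\alpha(x,E_\alpha(T))\}.$$ -/

import Mathlib

namespace DigitalImage

/-- The two notions of connectivity of digital images: `α = 4` and `α = 8`. -/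
inductive Connectivity where
  | four
  | eight

/-- The dual `β` of `α`: `(α, β) = (4, 8)` or `(α, β) = (8, 4)`. -/
def Connectivity.dual : Connectivity → Connectivity
  | .four => .eight
  | .eight => .four

/-- Pixels are the points of `ℤ²`. -/
abbrev Pixel := ℤ × ℤ

/-- The inclusion `ℤ² ⊆ ℝ²`. -/
def toPlane (p : Pixel) : ℝ × ℝ := ((p.1 : ℝ), (p.2 : ℝ))

/-- The metric `d_α` on `ℝ²`: `d₄` is the `ℓ¹` metric, `d₈` is the `ℓ^∞` metric. -/
def gridDist : Connectivity → ℝ × ℝ → ℝ × ℝ → ℝ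
  | .four, x, y => |x.1 - y.1| + |x.2 - y.2|
  | .eight, x, y => max |x.1 - y.1| |x.2 - y.2|

/-- The distance `d_α(x, S)` from a point `x` of the plane to a set `S` of pixels, as an infimum
in `[0, ∞]` (so that the distance to the empty set is `∞`). -/
noncomputable def distTo (α : Connectivity) (x : ℝ × ℝ) (S : Set Pixel) : ENNReal :=
  ⨅ z ∈ S, ENNReal.ofReal (gridDist α x (toPlane z))

/-- Two pixels are `d_α`-adjacent if their `d_α`-distance is `1`. -/
def PixelAdj (α : Connectivity) (x y : Pixel) : Prop :=
  gridDist α (toPlane x) (toPlane y) = 1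

theorem PixelAdj.symm {α : Connectivity} {x y : Pixel} (h : PixelAdj α x y) :
    PixelAdj α y x := by
  cases α <;> simpa only [PixelAdj, gridDist, abs_sub_comm] using h

theorem not_pixelAdj_self (α : Connectivity) (x : Pixel) : ¬ PixelAdj α x x := by
  cases α <;> simp [PixelAdj, gridDist]

/-- The graph on `ℤ²` given by `d_α`-adjacency. -/
def pixelGraph (α : Connectivity) : SimpleGraph Pixel where
  Adj := PixelAdj α
  symm := ⟨fun _ _ h => h.symm⟩
  loopless := ⟨fun x h => not_pixelAdj_self α x h⟩

/-- `T` is an `α`-connected component: a finite nonempty set of pixels any two of which are joined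
by a sequence of `d_α`-adjacent pixels inside `T`. (Such a `T` is a connected component of the image
in which exactly the pixels of `T` are white, and every finite component of an image is such a set;
`SimpleGraph.Connected` includes non-emptiness.) -/
def IsComponent (α : Connectivity) (T : Set Pixel) : Prop :=
  T.Finite ∧ ((pixelGraph α).induce T).Connected

/-- The two colors of a binary image. -/
inductive Color where
  | black
  | white

/-- Binary images with domain `ℤ²`. -/
abbrev Image := Pixel → Color

/-- The graph `I_α` of an image `I`: edges join white pixels that are `d_α`-adjacent and black
pixels that are `d_β`-adjacent. -/
def Image.graph (I : Image) (α : Connectivity) : SimpleGraph Pixel where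
  Adj x y := (I x = .white ∧ I y = .white ∧ PixelAdj α x y) ∨
    (I x = .black ∧ I y = .black ∧ PixelAdj α.dual x y)
  symm := ⟨fun _ _ h => h.imp (fun h => ⟨h.2.1, h.1, h.2.2.symm⟩)
    (fun h => ⟨h.2.1, h.1, h.2.2.symm⟩)⟩
  loopless := ⟨fun x h => h.elim (fun h => not_pixelAdj_self _ x h.2.2)
    (fun h => not_pixelAdj_self _ x h.2.2)⟩

/-- The site perimeter `P_α(T)`: the pixels outside `T` that are `d_α`-adjacent to `T`. -/
def sitePerimeter (α : Connectivity) (T : Set Pixel) : Set Pixel :=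
  {z | z ∉ T ∧ ∃ t ∈ T, PixelAdj α z t}

open Classical in
/-- The image that is black exactly on the set `P`. -/
noncomputable def blackImage (P : Set Pixel) : Image :=
  fun z => if z ∈ P then .black else .white

/-- The characteristic graph `G_α(T)` of the site perimeter of `T`. -/
noncomputable def charGraph (α : Connectivity) (T : Set Pixel) : SimpleGraph Pixel :=
  (blackImage (sitePerimeter α T)).graph α

/-- `E_α(T)`: the infinite connected component of `G_α(T)`, as the set of the pixels whose connected
component in `G_α(T)` is infinite. (`P_α(T)` is finite, so there is exactly one such component.) -/
def exterior (α : Connectivity) (T : Set Pixel) : Set Pixel :=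
  {z | ((charGraph α T).connectedComponentMk z).supp.Infinite}

/-- The vertex set of the exterior site perimeter `P_α^ext(T)`: the pixels of `P_α(T)` that are
`d_α`-adjacent to a pixel of `E_α(T)`. -/
def extPerimeter (α : Connectivity) (T : Set Pixel) : Set Pixel :=
  {z | z ∈ sitePerimeter α T ∧ ∃ e ∈ exterior α T, PixelAdj α z e}

/-- The embedding in `ℝ²` of the graph `P_α^ext(T)`, that is, of the subgraph of `G_α(T)` induced by
its vertex set: the union of the straight segments that join the end points of its edges. -/
def extPolygon (α : Connectivity) (T : Set Pixel) : Set (ℝ × ℝ) :=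
  {x | ∃ u ∈ extPerimeter α T, ∃ v ∈ extPerimeter α T,
    (charGraph α T).Adj u v ∧ x ∈ segment ℝ (toPlane u) (toPlane v)}

/-- `V_α(T)`: the open polygonal region bounded by the polygon `P_α^ext(T)`, that is, its inside:
the points off the polygon whose connected component in the complement of the polygon is bounded. -/
def region (α : Connectivity) (T : Set Pixel) : Set (ℝ × ℝ) :=
  {x | x ∉ extPolygon α T ∧
    Bornology.IsBounded (connectedComponentIn (extPolygon α T)ᶜ x)}

/-- `Z_α(T) = V_α(T) ∩ ℤ²`. -/
def interiorPixels (α : Connectivity) (T : Set Pixel) : Set Pixel :=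
  {z | toPlane z ∈ region α T}

end DigitalImage

/-!
Fix the exterior `E` and let `N` be the set of the pixels that are neither in `E` nor on the
exterior site perimeter; every pixel of the exterior site perimeter is `α`-adjacent to both `E` and
`N`. Close up a path through `E` by a segment of the polygon (or at a single vertex) to a mod 2
cycle. Since `N` stays connected off this cycle, all of `N` lies on one side of it. This parity
argument replaces the Jordan curve theorem: it shows that `E` and `N` lie on opposite sides of every
edge of the polygon. Consequently the polygon is exactly the set of the points of the plane that are
equidistant from `E` and `N`. Off the polygon the plane is the disjoint union of two open sets: the
points closer to `E`, which form a connected unbounded set, and the points closer to `N`, which form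
a bounded one.
-/

namespace DigitalImage

section Adjacency

variable {α : Connectivity} {x y : Pixel}

theorem pixelAdj_four_iff : PixelAdj .four x y ↔
    (x.1 = y.1 ∧ (x.2 = y.2 + 1 ∨ y.2 = x.2 + 1)) ∨
      (x.2 = y.2 ∧ (x.1 = y.1 + 1 ∨ y.1 = x.1 + 1)) := by
  have h : PixelAdj .four x y ↔ |x.1 - y.1| + |x.2 - y.2| = 1 := by
    simp only [PixelAdj, gridDist, toPlane]
    exact_mod_cast Iff.rfl
  rw [h]
  grind

theorem pixelAdj_eight_iff : PixelAdj .eight x y ↔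
    (x.1 ≠ y.1 ∨ x.2 ≠ y.2) ∧ x.1 ≤ y.1 + 1 ∧ y.1 ≤ x.1 + 1 ∧ x.2 ≤ y.2 + 1 ∧ y.2 ≤ x.2 + 1 := by
  have h : PixelAdj .eight x y ↔ max |x.1 - y.1| |x.2 - y.2| = 1 := by
    simp only [PixelAdj, gridDist, toPlane]
    exact_mod_cast Iff.rfl
  rw [h]
  grind

theorem PixelAdj.of_four (h : PixelAdj .four x y) : PixelAdj α x y := by
  cases α with
  | four => exact h
  | eight =>
    rw [pixelAdj_four_iff] at h
    rw [pixelAdj_eight_iff]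
    omega

theorem PixelAdj.eight (h : PixelAdj α x y) : PixelAdj .eight x y := by
  cases α with
  | four => exact h.of_four
  | eight => exact h

theorem PixelAdj.ne (h : PixelAdj α x y) : x ≠ y := by
  rintro rfl
  exact not_pixelAdj_self α x h

end Adjacency

/-! ### Mod 2 cycles and their potentials -/

/-- A mod 2 chain: a finite set of edges between pixels, encoded by its indicator function. -/
abbrev EdgeChain := Sym2 Pixel →₀ ZMod 2

/-- The eight pixels that are `d₈`-adjacent to `p`, column by column. -/
def kingNeighbors (p : Pixel) : Finset Pixel :=
  {(p.1 - 1, p.2 - 1), (p.1 - 1, p.2), (p.1 - 1, p.2 + 1), (p.1, p.2 - 1), (p.1, p.2 + 1),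
    (p.1 + 1, p.2 - 1), (p.1 + 1, p.2), (p.1 + 1, p.2 + 1)}

theorem mem_kingNeighbors {p z : Pixel} : z ∈ kingNeighbors p ↔ PixelAdj .eight p z := by
  obtain ⟨a, b⟩ := z
  simp only [kingNeighbors, Finset.mem_insert, Finset.mem_singleton, Prod.mk.injEq,
    pixelAdj_eight_iff]
  omega

/-- The coefficient at `p` of the mod 2 boundary of `c`. Edges of `c` whose ends are not
`d₈`-adjacent are ignored. -/
def boundary (c : EdgeChain) (p : Pixel) : ZMod 2 := ∑ z ∈ kingNeighbors p, c s(p, z)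

theorem boundary_add (c d : EdgeChain) : boundary (c + d) = boundary c + boundary d := by
  ext1 p
  simp [boundary, Finset.sum_add_distrib]

theorem boundary_single {a b : Pixel} (h : PixelAdj .eight a b) :
    boundary (Finsupp.single s(a, b) 1) = Pi.single a 1 + Pi.single b 1 := by
  ext1 p
  have key (z : Pixel) : (Finsupp.single s(a, b) 1 : EdgeChain) s(p, z) =
      (if z = b then if p = a then 1 else 0 else 0) +
        if z = a then if p = b then 1 else 0 else 0 := by
    have := h.ne
    simp only [Finsupp.single_apply, Sym2.eq_iff]
    grind
  have hb : p = a → b ∈ kingNeighbors p := by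
    rintro rfl
    exact mem_kingNeighbors.2 h
  have ha : p = b → a ∈ kingNeighbors p := by
    rintro rfl
    exact mem_kingNeighbors.2 h.symm
  simp only [boundary, key, Finset.sum_add_distrib, Finset.sum_ite_eq', Pi.add_apply,
    Pi.single_apply]
  grind

theorem boundary_eq_sum (c : EdgeChain) (x y : ℤ) : boundary c (x, y) =
    c s((x, y), (x - 1, y - 1)) + c s((x, y), (x - 1, y)) + c s((x, y), (x - 1, y + 1)) +
      c s((x, y), (x, y - 1)) + c s((x, y), (x, y + 1)) + c s((x, y), (x + 1, y - 1)) +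
      c s((x, y), (x + 1, y)) + c s((x, y), (x + 1, y + 1)) := by
  rw [boundary, kingNeighbors, Finset.sum_insert, Finset.sum_insert, Finset.sum_insert,
    Finset.sum_insert, Finset.sum_insert, Finset.sum_insert, Finset.sum_insert,
    Finset.sum_singleton]
  · ring
  all_goals simp only [Finset.mem_insert, Finset.mem_singleton, Prod.mk.injEq]; omega

/-- `F` records the side of the cycle `c`: `F (x, y)` is the value, on the left triangle of the unit
cell with lower left corner `(x, y)`, of a function on the complement of `c` that jumps by `1`
across every edge of `c`. The cell is cut into four triangles by its diagonals, and the equations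
follow the passage to the left triangle of the cell above and of the cell on the right. -/
structure IsPotential (c : EdgeChain) (F : Pixel → ZMod 2) : Prop where
  vertical : ∀ x y : ℤ, F (x, y) = F (x, y + 1) + c s((x, y + 1), (x + 1, y)) +
    c s((x, y + 1), (x + 1, y + 1)) + c s((x, y + 1), (x + 1, y + 2))
  horizontal : ∀ x y : ℤ, F (x, y) = F (x + 1, y) + c s((x, y), (x + 1, y + 1)) +
    c s((x, y + 1), (x + 1, y)) + c s((x + 1, y), (x + 1, y + 1))

theorem exists_eq_zero_of_lt_snd (c : EdgeChain) :
    ∃ B : ℤ, ∀ p z : Pixel, B < p.2 → c s(p, z) = 0 := by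
  obtain ⟨B, hB⟩ := (c.support.image fun e => (e.map Prod.snd).sup).exists_le
  refine ⟨B, fun p z hp => ?_⟩
  by_contra h
  have := hB _ (Finset.mem_image_of_mem _ (Finsupp.mem_support_iff.2 h))
  rw [Sym2.map_mk, Sym2.sup_mk] at this
  exact absurd (le_sup_left.trans this) (not_le.2 hp)

theorem exists_partial_sums_above {M : Type*} [AddCommMonoid M] {R : ℤ × ℤ → M} {B : ℤ}
    (hR : ∀ p, B < p.2 → R p = 0) : ∃ F : ℤ × ℤ → M, (∀ p, B ≤ p.2 → F p = 0) ∧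
      ∀ x y, F (x, y) = F (x, y + 1) + R (x, y + 1) := by
  have sum_eq_zero (x y : ℤ) (hy : B ≤ y) : ∑ k ∈ Finset.Ioc y B, R (x, k) = 0 := by
    rw [Finset.Ioc_eq_empty_of_le hy, Finset.sum_empty]
  refine ⟨fun p => ∑ k ∈ Finset.Ioc p.2 B, R (p.1, k), fun p => sum_eq_zero p.1 p.2, fun x y => ?_⟩
  dsimp only
  rcases lt_or_ge y B with hy | hy
  · rw [← Finset.insert_Ioc_add_one_left_eq_Ioc hy,
      Finset.sum_insert (by simp only [Finset.mem_Ioc]; omega), add_comm]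
  · rw [sum_eq_zero x y hy, sum_eq_zero x (y + 1) (by omega), hR _ (Int.lt_add_one_iff.2 hy),
      add_zero]

theorem exists_isPotential {c : EdgeChain} (hc : boundary c = 0) : ∃ F, IsPotential c F := by
  obtain ⟨B, hB⟩ := exists_eq_zero_of_lt_snd c
  have hB' (p z : Pixel) (hp : B < p.2) : c s(z, p) = 0 := Sym2.eq_swap (a := p) ▸ hB p z hp
  -- `F p` counts the edges that cross the upward ray that starts slightly to the right of `p`.
  obtain ⟨F, hF₀, hF⟩ := exists_partial_sums_above (B := B) (R := fun p : Pixel =>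
    c s(p, (p.1 + 1, p.2 - 1)) + c s(p, (p.1 + 1, p.2)) + c s(p, (p.1 + 1, p.2 + 1)))
    fun p hp => by simp only [hB p _ hp, add_zero]
  refine ⟨F, fun x y => ?_, fun x y => ?_⟩
  · rw [hF]
    simp only [add_sub_cancel_right, add_assoc, one_add_one_eq_two]
  have above (y : ℤ) (hy : B ≤ y) : F (x, y) = F (x + 1, y) + c s((x, y), (x + 1, y + 1)) +
      c s((x, y + 1), (x + 1, y)) + c s((x + 1, y), (x + 1, y + 1)) := by
    have hy' := Int.lt_add_one_iff.2 hy
    simp only [hF₀ (_, y) hy, hB (x, y + 1) _ hy', hB' (x + 1, y + 1) _ hy', add_zero]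
  rcases le_total B y with hy | hy
  · exact above y hy
  induction y, hy using Int.leInductionDown with
  | base => exact above B le_rfl
  | pred y _ ih =>
    have hb := congrFun hc (x + 1, y)
    have h1 := hF x (y - 1)
    have h2 := hF (x + 1) (y - 1)
    rw [boundary_eq_sum, Pi.zero_apply, Sym2.eq_swap, Sym2.eq_swap (b := (x + 1 - 1, y)),
      Sym2.eq_swap (b := (x + 1 - 1, y + 1)), Sym2.eq_swap (b := (x + 1, y - 1))] at hb
    simp only [sub_add_cancel, add_sub_cancel_right] at h1 h2 hb ⊢
    linear_combination (norm := (ring_nf; reduce_mod_char)) h1 - h2 + ih + hb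

theorem exists_edgeChain_of_reflTransGen {R : Pixel → Pixel → Prop}
    (hR : ∀ a b, R a b → PixelAdj .eight a b) {p q : Pixel} (h : Relation.ReflTransGen R p q) :
    ∃ c : EdgeChain, (∀ a b, c s(a, b) ≠ 0 → R a b ∨ R b a) ∧
      boundary c = Pi.single p 1 + Pi.single q 1 := by
  induction h with
  | refl => exact ⟨0, by simp, by simp [funext_iff, boundary, CharTwo.add_self_eq_zero]⟩
  | @tail b d _ hbd ih =>
    obtain ⟨c, hc, hbc⟩ := ih
    refine ⟨c + Finsupp.single s(b, d) 1, fun u v huv => ?_, ?_⟩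
    · by_cases hs : s(b, d) = s(u, v)
      · rcases Sym2.eq_iff.1 hs with ⟨rfl, rfl⟩ | ⟨rfl, rfl⟩
        exacts [Or.inl hbd, Or.inr hbd]
      · exact hc u v (by simpa [Finsupp.single_apply, hs] using huv)
    · rw [boundary_add, hbc, boundary_single (hR _ _ hbd)]
      linear_combination CharTwo.add_self_eq_zero (Pi.single b (1 : ZMod 2) : Pixel → ZMod 2)

/-- No edge of `c` ends at `p`. -/
def Avoids (c : EdgeChain) (p : Pixel) : Prop := ∀ z, c s(p, z) = 0

theorem Avoids.left {c : EdgeChain} {p : Pixel} (h : Avoids c p) (z : Pixel) : c s(z, p) = 0 :=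
  Sym2.eq_swap (a := p) ▸ h z

namespace IsPotential

variable {c : EdgeChain} {F : Pixel → ZMod 2}

theorem eq_above (hF : IsPotential c F) {x y : ℤ} (h : Avoids c (x, y + 1)) :
    F (x, y) = F (x, y + 1) := by
  rw [hF.vertical, h, h, h, add_zero, add_zero, add_zero]

theorem eq_above_right (hF : IsPotential c F) {x y : ℤ} (h : Avoids c (x + 1, y + 1)) :
    F (x, y) = F (x + 1, y + 1) + c s((x, y + 1), (x + 1, y)) := by
  rw [hF.horizontal, hF.vertical, h, h.left, h.left, h, h, add_zero, add_zero, add_zero, add_zero,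
    add_zero]

theorem eq_of_adj (hF : IsPotential c F) {p q : Pixel} (hp : Avoids c p) (hq : Avoids c q)
    (hpq : PixelAdj .eight p q) (hx : c s((p.1, q.2), (q.1, p.2)) = 0) : F p = F q := by
  wlog hle : p.1 < q.1 ∨ (p.1 = q.1 ∧ p.2 < q.2) generalizing p q
  · refine (this hq hp hpq.symm (Sym2.eq_swap ▸ hx) ?_).symm
    have := pixelAdj_eight_iff.1 hpq
    omega
  obtain ⟨x, y⟩ := p
  obtain ⟨x', y'⟩ := q
  rw [pixelAdj_eight_iff] at hpq
  simp only at hpq hle hx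
  obtain ⟨rfl, rfl⟩ | ⟨rfl, rfl | rfl | rfl⟩ : (x' = x ∧ y' = y + 1) ∨
      (x' = x + 1 ∧ (y' = y + 1 ∨ y' = y ∨ y = y' + 1)) := by omega
  · exact hF.eq_above hq
  · rw [hF.eq_above_right hq, hx, add_zero]
  · rw [hF.horizontal, hp, hq.left, hq, add_zero, add_zero, add_zero]
  · rw [← hF.eq_above hp, hF.horizontal, hp, hq, hx, add_zero, add_zero, add_zero]

end IsPotential

/-! ### Separations of the pixels -/

/-- The pixels in neither of the sets `E` (exterior) and `N` (inner). -/
def middle (E N : Set Pixel) : Set Pixel := {q | q ∉ E ∧ q ∉ N}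

/-- An `α`-step inside `K` that starts or ends in `N`. -/
def InnerStep (α : Connectivity) (N K : Set Pixel) (a b : Pixel) : Prop :=
  PixelAdj α a b ∧ a ∈ K ∧ b ∈ K ∧ (a ∈ N ∨ b ∈ N)

/-- A partition of the pixels into an `α`-connected set `E`, a set `N` that is not `α`-adjacent to
`E`, and a common boundary `middle E N` of both, such that the complement of `E` remains connected
when two pixels of the boundary are deleted. It axiomatizes the exterior of a component, the pixels
enclosed by the exterior site perimeter, and the exterior site perimeter. -/
structure Separation (α : Connectivity) (E N : Set Pixel) : Prop where
  disjoint : Disjoint E N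
  not_adj : ∀ n ∈ N, ∀ e ∈ E, ¬ PixelAdj α n e
  exists_exterior : ∀ q ∈ middle E N, ∃ e ∈ E, PixelAdj α q e
  exists_inner : ∀ q ∈ middle E N, ∃ n ∈ N, PixelAdj α q n
  connected : ∀ e ∈ E, ∀ e' ∈ E,
    Relation.ReflTransGen (fun a b => a ∈ E ∧ b ∈ E ∧ PixelAdj α a b) e e'
  compl_connected : ∀ q ∈ middle E N, ∀ q' ∈ middle E N,
    ∀ k ∉ E ∪ {q, q'}, ∀ k' ∉ E ∪ {q, q'},
      Relation.ReflTransGen (InnerStep α N (E ∪ {q, q'})ᶜ) k k'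

namespace Separation

variable {α : Connectivity} {E N : Set Pixel}

theorem notMem_of_inner (h : Separation α E N) {n : Pixel} (hn : n ∈ N) : n ∉ E :=
  h.disjoint.notMem_of_mem_right hn

theorem notMem_of_exterior (h : Separation α E N) {e : Pixel} (he : e ∈ E) : e ∉ N :=
  h.disjoint.notMem_of_mem_left he

theorem comap (h : Separation α E N) (σ : Pixel ≃ Pixel)
    (hσ : ∀ a b, PixelAdj α (σ a) (σ b) ↔ PixelAdj α a b) :
    Separation α (σ ⁻¹' E) (σ ⁻¹' N) := by
  have hσ' (a b) : PixelAdj α (σ.symm a) (σ.symm b) ↔ PixelAdj α a b := by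
    rw [← hσ, σ.apply_symm_apply, σ.apply_symm_apply]
  refine ⟨h.disjoint.preimage σ, fun n hn e he hne => h.not_adj _ hn _ he ((hσ _ _).2 hne),
    fun q hq => ?_, fun q hq => ?_, fun e he e' he' => ?_, fun q hq q' hq' k hk k' hk' => ?_⟩
  · obtain ⟨e, he, hqe⟩ := h.exists_exterior (σ q) hq
    exact ⟨σ.symm e, by simpa using he, by rwa [← hσ, σ.apply_symm_apply]⟩
  · obtain ⟨e, he, hqe⟩ := h.exists_inner (σ q) hq
    exact ⟨σ.symm e, by simpa using he, by rwa [← hσ, σ.apply_symm_apply]⟩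
  · have := (h.connected _ he _ he').lift
      (p := fun a b => a ∈ σ ⁻¹' E ∧ b ∈ σ ⁻¹' E ∧ PixelAdj α a b) σ.symm
      fun a b hab => by simpa [Function.onFun, hσ'] using hab
    simpa [Function.onFun] using this
  · have := (h.compl_connected (σ q) hq (σ q') hq' (σ k) (by simpa using hk) (σ k')
      (by simpa using hk')).lift (p := InnerStep α (σ ⁻¹' N) (σ ⁻¹' E ∪ {q, q'})ᶜ) σ.symm
      fun a b hab => by simpa [InnerStep, hσ', σ.symm_apply_eq] using hab
    simpa [Function.onFun] using this

/-- Reflection in the vertical axis. -/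
def reflectFst : Pixel ≃ Pixel := (Equiv.neg ℤ).prodCongr (Equiv.refl ℤ)

/-- Reflection in the horizontal axis. -/
def reflectSnd : Pixel ≃ Pixel := (Equiv.refl ℤ).prodCongr (Equiv.neg ℤ)

@[simp] theorem reflectFst_apply (p : Pixel) : reflectFst p = (-p.1, p.2) := rfl

@[simp] theorem reflectSnd_apply (p : Pixel) : reflectSnd p = (p.1, -p.2) := rfl

theorem swap (h : Separation α E N) : Separation α (Prod.swap ⁻¹' E) (Prod.swap ⁻¹' N) :=
  h.comap (Equiv.prodComm ℤ ℤ) fun a b => by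
    cases α <;> simp [PixelAdj, gridDist, toPlane, add_comm, max_comm]

theorem reflect_fst (h : Separation α E N) :
    Separation α (reflectFst ⁻¹' E) (reflectFst ⁻¹' N) :=
  h.comap reflectFst fun a b => by
    cases α <;> simp [PixelAdj, gridDist, toPlane, neg_add_eq_sub, abs_sub_comm]

theorem reflect_snd (h : Separation α E N) :
    Separation α (reflectSnd ⁻¹' E) (reflectSnd ⁻¹' N) :=
  h.comap reflectSnd fun a b => by
    cases α <;> simp [PixelAdj, gridDist, toPlane, neg_add_eq_sub, abs_sub_comm]

end Separation

/-- A mod 2 cycle whose edges are `α`-edges that meet `E`, and possibly the edge `qq'`. Since it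
leaves `E` only at `q` and `q'`, it fences off parts of the rest of the plane. -/
structure IsFence (α : Connectivity) (E : Set Pixel) (q q' : Pixel) (c : EdgeChain) : Prop where
  boundary_eq_zero : boundary c = 0
  avoids : ∀ p ∉ E ∪ {q, q'}, Avoids c p
  edge : ∀ a b, c s(a, b) ≠ 0 →
    (PixelAdj α a b ∧ (a ∈ E ∨ b ∈ E)) ∨ (s(a, b) = s(q, q') ∧ PixelAdj α.dual a b)

theorem IsFence.four_adj {E : Set Pixel} {q q' : Pixel} {c : EdgeChain}
    (hc : IsFence .four E q q' c) (hqq' : q = q' ∨ PixelAdj .four q q') {a b : Pixel}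
    (hab : c s(a, b) ≠ 0) : PixelAdj .four a b := by
  obtain ⟨h, -⟩ | ⟨hs, h⟩ := hc.edge a b hab
  · exact h
  · rcases hqq' with rfl | hqq'
    · rw [Sym2.eq_iff, or_self] at hs
      exact absurd (hs.1.trans hs.2.symm) h.ne
    · rcases Sym2.eq_iff.1 hs with ⟨rfl, rfl⟩ | ⟨rfl, rfl⟩
      exacts [hqq', hqq'.symm]

namespace Separation

variable {α : Connectivity} {E N : Set Pixel} {q q' e e' : Pixel}

theorem exists_arc (h : Separation α E N) (he : e ∈ E) (he' : e' ∈ E) (hqe : PixelAdj α q e)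
    (hqe' : PixelAdj α q' e') : ∃ c : EdgeChain, boundary c = Pi.single q 1 + Pi.single q' 1 ∧
      (∀ a b, c s(a, b) ≠ 0 → PixelAdj α a b ∧ (a ∈ E ∨ b ∈ E)) ∧
      ∀ p ∉ E, ∀ z, c s(p, z) = (if s(q, e) = s(p, z) then 1 else 0) +
        if s(q', e') = s(p, z) then 1 else 0 := by
  obtain ⟨c, hc, hbc⟩ := exists_edgeChain_of_reflTransGen (fun _ _ hab => hab.2.2.eight)
    (h.connected e he e' he')
  refine ⟨c + (Finsupp.single s(q, e) 1 + Finsupp.single s(q', e') 1), ?_, fun a b hab => ?_,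
    fun p hp z => ?_⟩
  · rw [boundary_add, boundary_add, hbc, boundary_single hqe.eight, boundary_single hqe'.eight]
    linear_combination CharTwo.add_self_eq_zero (Pi.single e (1 : ZMod 2) : Pixel → ZMod 2) +
      CharTwo.add_self_eq_zero (Pi.single e' (1 : ZMod 2) : Pixel → ZMod 2)
  · by_cases hs : s(q, e) = s(a, b)
    · rcases Sym2.eq_iff.1 hs with ⟨rfl, rfl⟩ | ⟨rfl, rfl⟩
      exacts [⟨hqe, Or.inr he⟩, ⟨hqe.symm, Or.inl he⟩]
    by_cases hs' : s(q', e') = s(a, b)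
    · rcases Sym2.eq_iff.1 hs' with ⟨rfl, rfl⟩ | ⟨rfl, rfl⟩
      exacts [⟨hqe', Or.inr he'⟩, ⟨hqe'.symm, Or.inl he'⟩]
    rcases hc a b (by simpa [Finsupp.single_apply, hs, hs'] using hab) with hab | hab
    exacts [⟨hab.2.2, Or.inl hab.1⟩, ⟨hab.2.2.symm, Or.inl hab.2.1⟩]
  · have : c s(p, z) = 0 := by
      by_contra hpz
      exact hp ((hc p z hpz).elim (fun hpz => hpz.1) fun hpz => hpz.2.1)
    simp only [Finsupp.add_apply, this, Finsupp.single_apply, zero_add]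

theorem exists_isFence_edge (h : Separation α E N) (hq : q ∈ middle E N) (hq' : q' ∈ middle E N)
    (hqq' : PixelAdj α.dual q q') : ∃ c, IsFence α E q q' c ∧ c s(q, q') = 1 := by
  obtain ⟨e, he, hqe⟩ := h.exists_exterior q hq
  obtain ⟨e', he', hqe'⟩ := h.exists_exterior q' hq'
  obtain ⟨c, hbc, hc, hpc⟩ := h.exists_arc he he' hqe hqe'
  have heq : e ≠ q' := fun hh => hq'.1 (hh ▸ he)
  have heq' : e' ≠ q := fun hh => hq.1 (hh ▸ he')
  refine ⟨c + Finsupp.single s(q, q') 1, ⟨?_, fun p hp z => ?_, fun a b hab => ?_⟩, ?_⟩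
  · rw [boundary_add, hbc, boundary_single hqq'.eight]
    exact CharTwo.add_self_eq_zero _
  · simp only [Set.mem_union, Set.mem_insert_iff, Set.mem_singleton_iff, not_or] at hp
    have hne : e ≠ p := fun hh => hp.1 (hh ▸ he)
    have hne' : e' ≠ p := fun hh => hp.1 (hh ▸ he')
    simp [hpc p hp.1, hne, hne', Ne.symm hp.2.1, Ne.symm hp.2.2]
  · by_cases hs : s(q, q') = s(a, b)
    · rcases Sym2.eq_iff.1 hs with ⟨rfl, rfl⟩ | ⟨rfl, rfl⟩
      exacts [Or.inr ⟨hs.symm, hqq'⟩, Or.inr ⟨hs.symm, hqq'.symm⟩]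
    · exact Or.inl (hc a b (by simpa [Finsupp.single_apply, hs] using hab))
  · simp [hpc q hq.1, heq, heq', hqq'.ne, hqq'.ne.symm]

theorem exists_isFence_corner (h : Separation α E N) (hq : q ∈ middle E N) (he : e ∈ E)
    (he' : e' ∈ E) (hqe : PixelAdj α q e) (hqe' : PixelAdj α q e') :
    ∃ c, IsFence α E q q c ∧
      ∀ z, c s(q, z) = (if e = z then 1 else 0) + if e' = z then 1 else 0 := by
  obtain ⟨c, hbc, hc, hpc⟩ := h.exists_arc he he' hqe hqe'
  refine ⟨c, ⟨hbc.trans (CharTwo.add_self_eq_zero _), fun p hp z => ?_, fun a b hab =>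
    Or.inl (hc a b hab)⟩, fun z => by simp only [hpc q hq.1, Sym2.congr_right]⟩
  simp only [Set.mem_union, Set.mem_insert_iff, Set.mem_singleton_iff, or_self, not_or] at hp
  have hne : e ≠ p := fun hh => hp.1 (hh ▸ he)
  have hne' : e' ≠ p := fun hh => hp.1 (hh ▸ he')
  simp [hpc p hp.1, hne, hne', Ne.symm hp.2]

theorem diagonal_eq_zero (h : Separation .eight E N) {c : EdgeChain} (hc : IsFence .eight E q q' c)
    {a b : Pixel} (hab : PixelAdj .eight a b) (hN : a ∈ N ∨ b ∈ N) (h1 : a.1 ≠ b.1)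
    (h2 : a.2 ≠ b.2) : c s((a.1, b.2), (b.1, a.2)) = 0 := by
  rw [pixelAdj_eight_iff] at hab
  have hE (u : Pixel) (hu : u = (a.1, b.2) ∨ u = (b.1, a.2)) : u ∉ E := fun huE => by
    rcases hN with hN | hN <;> refine h.not_adj _ hN _ huE (pixelAdj_eight_iff.2 ?_) <;>
      rcases hu with rfl | rfl <;> dsimp only <;> omega
  by_contra hne
  rcases hc.edge _ _ hne with ⟨-, hu | hu⟩ | ⟨-, hu⟩
  · exact hE _ (Or.inl rfl) hu
  · exact hE _ (Or.inr rfl) hu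
  · rw [Connectivity.dual, pixelAdj_four_iff] at hu
    omega

theorem potential_eq (h : Separation α E N) (hq : q ∈ middle E N) (hq' : q' ∈ middle E N)
    {c : EdgeChain} (hc : IsFence α E q q' c) {F : Pixel → ZMod 2} (hF : IsPotential c F)
    {k k' : Pixel} (hk : k ∉ E ∪ {q, q'}) (hk' : k' ∉ E ∪ {q, q'}) : F k = F k' := by
  induction h.compl_connected q hq q' hq' k hk k' hk' with
  | refl => rfl
  | @tail a b _ hab ih =>
    obtain ⟨hadj, ha, hb, hN⟩ := hab
    rw [ih ha]
    refine hF.eq_of_adj (hc.avoids a ha) (hc.avoids b hb) hadj.eight ?_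
    by_cases h1 : a.1 = b.1
    · rw [h1]
      exact hc.avoids b hb _
    by_cases h2 : a.2 = b.2
    · rw [← h2]
      exact hc.avoids a ha _
    cases α with
    | four =>
      rw [pixelAdj_four_iff] at hadj
      omega
    | eight => exact h.diagonal_eq_zero hc hadj hN h1 h2

end Separation

/-! ### Local structure of the boundary -/

namespace IsPotential

variable {c : EdgeChain} {F : Pixel → ZMod 2}

theorem vertical_of_four (hF : IsPotential c F) (h4 : ∀ a b, c s(a, b) ≠ 0 → PixelAdj .four a b)
    (x y : ℤ) : F (x, y) = F (x, y + 1) + c s((x, y + 1), (x + 1, y + 1)) := by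
  have hd : c s((x, y + 1), (x + 1, y)) = 0 :=
    of_not_not fun hne => by simpa [pixelAdj_four_iff] using h4 _ _ hne
  have hu : c s((x, y + 1), (x + 1, y + 2)) = 0 :=
    of_not_not fun hne => by simpa [pixelAdj_four_iff] using h4 _ _ hne
  rw [hF.vertical, hd, hu, add_zero, add_zero]

theorem horizontal_of_four (hF : IsPotential c F) (h4 : ∀ a b, c s(a, b) ≠ 0 → PixelAdj .four a b)
    (x y : ℤ) : F (x, y) = F (x + 1, y) + c s((x + 1, y), (x + 1, y + 1)) := by
  have hu : c s((x, y), (x + 1, y + 1)) = 0 :=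
    of_not_not fun hne => by simpa [pixelAdj_four_iff] using h4 _ _ hne
  have hd : c s((x, y + 1), (x + 1, y)) = 0 :=
    of_not_not fun hne => by simpa [pixelAdj_four_iff] using h4 _ _ hne
  rw [hF.horizontal, hd, hu, add_zero, add_zero]

end IsPotential

namespace Separation

variable {α : Connectivity} {E N : Set Pixel} {x y : ℤ}

theorem four_side_exterior (h : Separation .four E N) (hq : (x, y) ∈ middle E N)
    (hq' : (x + 1, y) ∈ middle E N) :
    ((x, y + 1) ∈ E ∧ (x + 1, y + 1) ∈ E) ∨ ((x, y - 1) ∈ E ∧ (x + 1, y - 1) ∈ E) := by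
  by_contra! hcon
  have hqq' : PixelAdj .four (x, y) (x + 1, y) := pixelAdj_four_iff.2 (by simp)
  obtain ⟨c, hc, hcq⟩ := h.exists_isFence_edge hq hq' hqq'.of_four
  obtain ⟨F, hF⟩ := exists_isPotential hc.boundary_eq_zero
  have h4 (a b : Pixel) : c s(a, b) ≠ 0 → PixelAdj .four a b := hc.four_adj (Or.inr hqq')
  have exists_side (z : ℤ) (hz : z ≠ y) (hE : (x, z) ∈ E → (x + 1, z) ∉ E) :
      c s((x, z), (x + 1, z)) = 0 ∧ ∃ u ∉ E ∪ {(x, y), (x + 1, y)}, F u = F (x, z) := by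
    by_cases hl : (x, z) ∈ E
    · have hr : (x + 1, z) ∉ E ∪ {(x, y), (x + 1, y)} := by simp [hE hl, hz]
      refine ⟨(hc.avoids _ hr).left _, _, hr, ?_⟩
      rw [hF.horizontal_of_four h4 x, hc.avoids _ hr, add_zero]
    · have hl' : (x, z) ∉ E ∪ {(x, y), (x + 1, y)} := by simp [hl, hz]
      exact ⟨hc.avoids _ hl' _, _, hl', rfl⟩
  obtain ⟨h0, u, hu, hFu⟩ := exists_side (y + 1) (by simp) hcon.1
  obtain ⟨-, v, hv, hFv⟩ := exists_side (y - 1) (by simp) hcon.2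
  have above := hF.vertical_of_four h4 x y
  have below := hF.vertical_of_four h4 x (y - 1)
  rw [h0, add_zero] at above
  rw [sub_add_cancel, hcq, above, ← hFu, ← hFv, h.potential_eq hq hq' hc hF hu hv] at below
  simp at below

theorem eight_side_exterior (h : Separation .eight E N) (hq : (x, y) ∈ middle E N)
    (hq' : (x + 1, y) ∈ middle E N) :
    ((x, y + 1) ∈ E ∨ (x + 1, y + 1) ∈ E) ∨ ((x, y - 1) ∈ E ∨ (x + 1, y - 1) ∈ E) := by
  by_contra! ⟨⟨hu, hu'⟩, hd, hd'⟩
  obtain ⟨c, hc, hcq⟩ := h.exists_isFence_edge hq hq' (pixelAdj_four_iff.2 (by simp))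
  obtain ⟨F, hF⟩ := exists_isPotential hc.boundary_eq_zero
  have hu : (x, y + 1) ∉ E ∪ {(x, y), (x + 1, y)} := by simp [hu]
  have hu' : (x + 1, y + 1) ∉ E ∪ {(x, y), (x + 1, y)} := by simp [hu']
  have hd : (x, y - 1) ∉ E ∪ {(x, y), (x + 1, y)} := by simp [hd]
  have hd' : (x + 1, y - 1) ∉ E ∪ {(x, y), (x + 1, y)} := by simp [hd']
  have below := hF.vertical x (y - 1)
  rw [sub_add_cancel, show y - 1 + 2 = y + 1 by ring, hcq, (hc.avoids _ hd').left,
    (hc.avoids _ hu').left, hF.eq_above (hc.avoids _ hu), h.potential_eq hq hq' hc hF hd hu]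
    at below
  simp at below

theorem four_diag_exterior (h : Separation .four E N) (hq : (x, y) ∈ middle E N)
    (hq' : (x + 1, y + 1) ∈ middle E N) : (x, y + 1) ∈ E ∨ (x + 1, y) ∈ E := by
  by_contra! ⟨hu, hv⟩
  obtain ⟨c, hc, hcq⟩ := h.exists_isFence_edge hq hq' (pixelAdj_eight_iff.2 (by simp only; omega))
  obtain ⟨F, hF⟩ := exists_isPotential hc.boundary_eq_zero
  have hu : (x, y + 1) ∉ E ∪ {(x, y), (x + 1, y + 1)} := by simp [hu]
  have hv : (x + 1, y) ∉ E ∪ {(x, y), (x + 1, y + 1)} := by simp [hv]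
  have key := hF.horizontal x y
  rw [hcq, hc.avoids _ hu, hc.avoids _ hv, hF.eq_above (hc.avoids _ hu),
    h.potential_eq hq hq' hc hF hu hv] at key
  simp at key

theorem four_diag_not_exterior (h : Separation .four E N) (hq : (x, y) ∈ middle E N)
    (hq' : (x + 1, y + 1) ∈ middle E N) (hu : (x, y + 1) ∈ E) : (x + 1, y) ∉ E := by
  intro hv
  obtain ⟨c, hc, hcq⟩ := h.exists_isFence_corner hq hu hv (pixelAdj_four_iff.2 (by simp))
    (pixelAdj_four_iff.2 (by simp))
  obtain ⟨F, hF⟩ := exists_isPotential hc.boundary_eq_zero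
  have h4 (a b : Pixel) : c s(a, b) ≠ 0 → PixelAdj .four a b := hc.four_adj (Or.inl rfl)
  have hq'c : (x + 1, y + 1) ∉ E ∪ {(x, y), (x, y)} := by simp [hq'.1]
  obtain ⟨n, hn, hqn⟩ := h.exists_inner _ hq
  have hnE := h.notMem_of_inner hn
  have hnc : n ∉ E ∪ {(x, y), (x, y)} := by simp [hnE, hqn.ne.symm]
  have hFq : F (x, y) = F (x + 1, y + 1) := by
    rw [hF.vertical_of_four h4, (hc.avoids _ hq'c).left, add_zero, hF.horizontal_of_four h4,
      hc.avoids _ hq'c, add_zero]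
  have hFn : F n = F (x, y) + 1 := by
    obtain rfl | rfl : n = (x - 1, y) ∨ n = (x, y - 1) := by
      rw [pixelAdj_four_iff] at hqn
      grind
    · have := hF.horizontal_of_four h4 (x - 1) y
      simpa [hcq] using this
    · have := hF.vertical_of_four h4 x (y - 1)
      simpa [hcq] using this
  rw [h.potential_eq hq hq hc hF hnc hq'c, hFq] at hFn
  simp at hFn

theorem left_notMem_exterior (h : Separation α E N) (hq : (x, y) ∈ middle E N)
    (hq' : (x + 1, y) ∈ middle E N) {e e' : Pixel} (he : e ∈ E) (he' : e' ∈ E)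
    (hqe : PixelAdj α (x, y) e) (hqe' : PixelAdj α (x, y) e')
    (hu : e = (x, y + 1) ∨ e = (x + 1, y + 1)) (hd : e' = (x, y - 1) ∨ e' = (x + 1, y - 1)) :
    (x - 1, y) ∉ E := by
  intro hw
  obtain ⟨n, hn, hqn⟩ := h.exists_inner _ hq
  have hnE := h.notMem_of_inner hn
  have hne := h.not_adj n hn e he
  have hne' := h.not_adj n hn e' he'
  have hnw := h.not_adj n hn _ hw
  have hnq' := hq'.2
  cases α with
  | four =>
    simp only [pixelAdj_four_iff] at *
    grind
  | eight =>
    simp only [pixelAdj_eight_iff] at *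
    grind

theorem not_exterior_both_sides (h : Separation α E N) (hq : (x, y) ∈ middle E N)
    (hq' : (x + 1, y) ∈ middle E N) {e e' : Pixel} (he : e ∈ E) (he' : e' ∈ E)
    (hqe : PixelAdj α (x, y) e) (hqe' : PixelAdj α (x, y) e')
    (hu : e = (x, y + 1) ∨ e = (x + 1, y + 1)) (hd : e' = (x, y - 1) ∨ e' = (x + 1, y - 1)) :
    False := by
  obtain ⟨c, hc, hcq⟩ := h.exists_isFence_corner hq he he' hqe hqe'
  obtain ⟨F, hF⟩ := exists_isPotential hc.boundary_eq_zero
  have hw : (x - 1, y) ∉ E ∪ {(x, y), (x, y)} := by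
    simp [h.left_notMem_exterior hq hq' he he' hqe hqe' hu hd]
  have hq'c : (x + 1, y) ∉ E ∪ {(x, y), (x, y)} := by simp [hq'.1]
  -- exactly one of the three upper neighbours of `(x, y)` is joined to it by the fence
  have right := hF.horizontal x y
  have left := hF.horizontal (x - 1) y
  rw [sub_add_cancel, hc.avoids _ hw, Sym2.eq_swap (a := (x - 1, y + 1)), hcq, hcq, right,
    hcq, (hc.avoids _ hq'c).left, hc.avoids _ hq'c, h.potential_eq hq hq hc hF hw hq'c] at left
  revert left
  rcases hu with rfl | rfl <;> rcases hd with rfl | rfl <;>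
    simp [show ¬ x = x - 1 by omega, show ¬ y - 1 = y + 1 by omega,
      show ¬ x + 1 = x - 1 by omega]

theorem four_inner_above (h : Separation .four E N) (hq : (x, y) ∈ middle E N)
    (hq' : (x + 1, y) ∈ middle E N) (hd : (x, y - 1) ∈ E) : (x, y + 1) ∈ N := by
  have hu : (x, y + 1) ∉ E := fun hu => h.not_exterior_both_sides hq hq' hu hd
    (pixelAdj_four_iff.2 (by simp)) (pixelAdj_four_iff.2 (by simp)) (Or.inl rfl) (Or.inl rfl)
  by_contra huN
  have hl : (x - 1, y) ∈ E :=
    ((h.swap.four_side_exterior (x := y) (y := x) hq ⟨hu, huN⟩).resolve_left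
      fun h' => hq'.1 h'.1).1
  obtain ⟨n, hn, hqn⟩ := h.exists_inner _ hq
  have hdN := h.notMem_of_exterior hd
  have hlN := h.notMem_of_exterior hl
  have hrN := hq'.2
  rw [pixelAdj_four_iff] at hqn
  grind

theorem four_inner_above_right (h : Separation .four E N) (hq : (x, y) ∈ middle E N)
    (hq' : (x + 1, y) ∈ middle E N) (hd : (x + 1, y - 1) ∈ E) : (x + 1, y + 1) ∈ N := by
  have := h.reflect_fst.four_inner_above (x := -(x + 1)) (y := y)
    (show (_, _) ∈ middle E N by simpa using hq') (show (_, _) ∈ middle E N by simpa using hq)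
    (by simpa using hd)
  simpa using this

theorem four_edge (h : Separation .four E N) (hq : (x, y) ∈ middle E N)
    (hq' : (x + 1, y) ∈ middle E N) :
    (((x, y + 1) ∈ N ∧ (x + 1, y + 1) ∈ N) ∧ ((x, y - 1) ∈ E ∧ (x + 1, y - 1) ∈ E)) ∨
      (((x, y + 1) ∈ E ∧ (x + 1, y + 1) ∈ E) ∧ ((x, y - 1) ∈ N ∧ (x + 1, y - 1) ∈ N)) := by
  rcases h.four_side_exterior hq hq' with hu | hd
  · have hr : (x, -y) ∈ middle (reflectSnd ⁻¹' E) (reflectSnd ⁻¹' N) :=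
      show (_, _) ∈ middle E N by simpa using hq
    have hr' : (x + 1, -y) ∈ middle (reflectSnd ⁻¹' E) (reflectSnd ⁻¹' N) :=
      show (_, _) ∈ middle E N by simpa using hq'
    have hl := h.reflect_snd.four_inner_above hr hr' (by simpa [add_comm] using hu.1)
    have hl' := h.reflect_snd.four_inner_above_right hr hr' (by simpa [add_comm] using hu.2)
    exact Or.inr ⟨hu, by simpa [← sub_eq_neg_add] using hl, by simpa [← sub_eq_neg_add] using hl'⟩
  · exact Or.inl ⟨⟨h.four_inner_above hq hq' hd.1, h.four_inner_above_right hq hq' hd.2⟩, hd⟩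

theorem four_diag (h : Separation .four E N) (hq : (x, y) ∈ middle E N)
    (hq' : (x + 1, y + 1) ∈ middle E N) :
    ((x, y + 1) ∈ E ∧ (x + 1, y) ∈ N) ∨ ((x, y + 1) ∈ N ∧ (x + 1, y) ∈ E) := by
  by_cases hu : (x, y + 1) ∈ E
  · refine Or.inl ⟨hu, ?_⟩
    by_contra hv
    rcases h.four_edge hq ⟨h.four_diag_not_exterior hq hq' hu, hv⟩ with h' | h'
    · exact hq'.2 h'.1.2
    · exact hq'.1 h'.1.2
  · refine Or.inr ⟨?_, (h.four_diag_exterior hq hq').resolve_left hu⟩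
    by_contra hu'
    rcases h.four_edge ⟨hu, hu'⟩ hq' with h' | h'
    · exact hq.1 (by simpa using h'.2.1)
    · exact hq.2 (by simpa using h'.2.1)

theorem four_antidiag (h : Separation .four E N) (hq : (x + 1, y) ∈ middle E N)
    (hq' : (x, y + 1) ∈ middle E N) :
    ((x + 1, y + 1) ∈ E ∧ (x, y) ∈ N) ∨ ((x + 1, y + 1) ∈ N ∧ (x, y) ∈ E) := by
  have := h.reflect_fst.four_diag (x := -(x + 1)) (y := y)
    (show (_, _) ∈ middle E N by simpa using hq) (show (_, _) ∈ middle E N by simpa using hq')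
  simpa using this

theorem eight_inner_corner (h : Separation .eight E N) (h00 : (x, y) ∈ middle E N)
    (h10 : (x + 1, y) ∈ middle E N) (h01 : (x, y + 1) ∈ middle E N)
    (h11 : (x + 1, y + 1) ∈ middle E N) : (x - 1, y - 1) ∈ N := by
  have hb : (x, y - 1) ∈ E ∨ (x + 1, y - 1) ∈ E :=
    (h.eight_side_exterior h00 h10).resolve_left (not_or.2 ⟨h01.1, h11.1⟩)
  have hl : (x - 1, y) ∈ E ∨ (x - 1, y + 1) ∈ E :=
    (h.swap.eight_side_exterior (x := y) (y := x) h00 h01).resolve_left (not_or.2 ⟨h10.1, h11.1⟩)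
  obtain ⟨⟨a, b⟩, hn, hqn⟩ := h.exists_inner _ h00
  have not_near (e : Pixel) (he : e ∈ E) :
      e.1 + 1 < a ∨ a + 1 < e.1 ∨ e.2 + 1 < b ∨ b + 1 < e.2 := by
    have hadj := h.not_adj _ hn e he
    have hne : (a, b) ≠ e := fun hne => h.notMem_of_exterior he (hne ▸ hn)
    rw [pixelAdj_eight_iff] at hadj
    rw [ne_eq, Prod.ext_iff] at hne
    omega
  have not_corner (p : Pixel) (hp : p ∈ middle E N) : ¬ (a = p.1 ∧ b = p.2) := by
    rintro ⟨rfl, rfl⟩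
    exact hp.2 hn
  have n10 := not_corner _ h10
  have n01 := not_corner _ h01
  have n11 := not_corner _ h11
  have nb := hb.imp (not_near _) (not_near _)
  have nl := hl.imp (not_near _) (not_near _)
  rw [pixelAdj_eight_iff] at hqn
  obtain ⟨rfl, rfl⟩ : a = x - 1 ∧ b = y - 1 := by
    dsimp only at *
    omega
  exact hn

theorem eight_cell (h : Separation .eight E N) (h00 : (x, y) ∈ middle E N)
    (h10 : (x + 1, y) ∈ middle E N) (h01 : (x, y + 1) ∈ middle E N) :
    (x + 1, y + 1) ∉ middle E N := by
  intro h11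
  have hl := h.eight_inner_corner h00 h10 h01 h11
  have hr : (x + 2, y - 1) ∈ N := by
    have := h.reflect_fst.eight_inner_corner (x := -(x + 1)) (y := y)
      (show (_, _) ∈ middle E N by simpa using h10) (show (_, _) ∈ middle E N by simpa using h00)
      (show (_, _) ∈ middle E N by simpa using h11) (show (_, _) ∈ middle E N by simpa using h01)
    simpa [show 1 - (-1 + -x) = x + 2 by ring] using this
  rcases (h.eight_side_exterior h00 h10).resolve_left (not_or.2 ⟨h01.1, h11.1⟩) with hb | hb
  · exact h.not_adj _ hl _ hb (pixelAdj_eight_iff.2 (by simp only; omega))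
  · exact h.not_adj _ hr _ hb (pixelAdj_eight_iff.2 (by simp only; omega))

theorem eight_inner_below (h : Separation .eight E N) (hq : (x, y) ∈ middle E N)
    (hq' : (x + 1, y) ∈ middle E N) (hu : (x, y + 1) ∈ E ∨ (x + 1, y + 1) ∈ E) :
    (x, y - 1) ∈ N ∨ (x + 1, y - 1) ∈ N := by
  have hd (a : ℤ) (ha : a = x ∨ a = x + 1) : (a, y - 1) ∉ E := fun hE => by
    obtain ⟨b, hb, hbE⟩ : ∃ b, (b = x ∨ b = x + 1) ∧ (b, y + 1) ∈ E := by simpa using hu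
    exact h.not_exterior_both_sides hq hq' hbE hE (pixelAdj_eight_iff.2 (by simp only; omega))
      (pixelAdj_eight_iff.2 (by simp only; omega)) (by simpa using hb) (by simpa using ha)
  by_contra! hcon
  exact h.eight_cell (x := x) (y := y - 1) ⟨hd _ (by simp), hcon.1⟩ ⟨hd _ (by simp), hcon.2⟩
    (by simpa using hq) (by simpa using hq')

theorem eight_edge (h : Separation .eight E N) (hq : (x, y) ∈ middle E N)
    (hq' : (x + 1, y) ∈ middle E N) :
    (((x, y + 1) ∈ E ∨ (x + 1, y + 1) ∈ E) ∧ ((x, y - 1) ∈ N ∨ (x + 1, y - 1) ∈ N)) ∨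
      (((x, y + 1) ∈ N ∨ (x + 1, y + 1) ∈ N) ∧ ((x, y - 1) ∈ E ∨ (x + 1, y - 1) ∈ E)) := by
  rcases h.eight_side_exterior hq hq' with hu | hd
  · exact Or.inl ⟨hu, h.eight_inner_below hq hq' hu⟩
  · refine Or.inr ⟨?_, hd⟩
    have := h.reflect_snd.eight_inner_below (x := x) (y := -y)
      (show (_, _) ∈ middle E N by simpa using hq) (show (_, _) ∈ middle E N by simpa using hq')
      (by simpa [← sub_eq_neg_add] using hd)
    simpa [add_comm] using this

theorem exterior_iff_of_adj (h : Separation α E N) {a b : Pixel} (hab : PixelAdj α a b)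
    (ha : a ∉ middle E N) (hb : b ∉ middle E N) : a ∈ E ↔ b ∈ E := by
  have mem_of {p q : Pixel} (hpq : PixelAdj α p q) (hq : q ∉ middle E N) (hp : p ∈ E) : q ∈ E := by
    by_contra hqE
    exact hq ⟨hqE, fun hqN => h.not_adj q hqN p hp hpq.symm⟩
  exact ⟨mem_of hab hb, mem_of hab.symm ha⟩

theorem exterior_iff_of_four_adj (h : Separation α E N)
    (hm : ∀ p ∈ middle E N, ¬ PixelAdj α.dual (x, y) p) {z : Pixel} (hz : PixelAdj .four (x, y) z) :
    z ∈ E ↔ (x, y + 1) ∈ E := by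
  have turn (i j : ℤ) (hi : i = 1 ∨ i = -1) (hj : j = 1 ∨ j = -1) :
      (x + i, y) ∈ E ↔ (x, y + j) ∈ E := by
    have hI : PixelAdj .four (x, y) (x + i, y) := pixelAdj_four_iff.2 (by grind)
    have hJ : PixelAdj .four (x, y) (x, y + j) := pixelAdj_four_iff.2 (by grind)
    have hI' := fun hp => hm _ hp hI.of_four
    have hJ' := fun hp => hm _ hp hJ.of_four
    cases α with
    | four =>
      have hIJ := fun hp => hm (x + i, y + j) hp (pixelAdj_eight_iff.2 (by grind))
      exact (h.exterior_iff_of_adj (pixelAdj_four_iff.2 (by grind)) hI' hIJ).trans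
        (h.exterior_iff_of_adj (pixelAdj_four_iff.2 (by grind)) hIJ hJ')
    | eight => exact h.exterior_iff_of_adj (pixelAdj_eight_iff.2 (by grind)) hI' hJ'
  obtain ⟨i, hi, rfl | rfl⟩ : ∃ i : ℤ, (i = 1 ∨ i = -1) ∧ (z = (x + i, y) ∨ z = (x, y + i)) := by
    rw [pixelAdj_four_iff] at hz
    obtain ⟨hx, hy⟩ | ⟨hy, hx⟩ := hz
    · exact ⟨z.2 - y, by grind⟩
    · exact ⟨z.1 - x, by grind⟩
  · exact turn i 1 hi (Or.inl rfl)
  · exact (turn 1 i (Or.inl rfl) hi).symm.trans (turn 1 1 (Or.inl rfl) (Or.inl rfl))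

theorem exterior_iff_of_adj_isolated (h : Separation α E N)
    (hm : ∀ p ∈ middle E N, ¬ PixelAdj α.dual (x, y) p) {z : Pixel} (hz : PixelAdj α (x, y) z)
    (hzm : z ∉ middle E N) : z ∈ E ↔ (x, y + 1) ∈ E := by
  by_cases hz4 : PixelAdj .four (x, y) z
  · exact h.exterior_iff_of_four_adj hm hz4
  cases α with
  | four => exact absurd hz hz4
  | eight =>
    have hz' : PixelAdj .four (x, y) (z.1, y) := by
      rw [pixelAdj_eight_iff] at hz
      rw [pixelAdj_four_iff] at hz4 ⊢
      grind
    have hzz' : PixelAdj .eight z (z.1, y) := by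
      rw [pixelAdj_eight_iff] at hz ⊢
      rw [pixelAdj_four_iff] at hz4
      grind
    exact (h.exterior_iff_of_adj hzz' hzm fun hp => hm _ hp hz').trans
      (h.exterior_iff_of_four_adj hm hz')

theorem exists_middle_adj (h : Separation α E N) {q : Pixel} (hq : q ∈ middle E N) :
    ∃ q' ∈ middle E N, PixelAdj α.dual q q' := by
  by_contra! hm
  obtain ⟨e, he, hqe⟩ := h.exists_exterior q hq
  obtain ⟨n, hn, hqn⟩ := h.exists_inner q hq
  exact h.notMem_of_inner hn <| (h.exterior_iff_of_adj_isolated hm hqn fun hp => hp.2 hn).2 <|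
    (h.exterior_iff_of_adj_isolated hm hqe fun hp => hp.1 he).1 he

end Separation

/-! ### The characteristic graph -/

section CharGraph

open Relation SimpleGraph

variable {α : Connectivity} {T : Set Pixel}

theorem charGraph_adj {x y : Pixel} : (charGraph α T).Adj x y ↔
    (x ∉ sitePerimeter α T ∧ y ∉ sitePerimeter α T ∧ PixelAdj α x y) ∨
      (x ∈ sitePerimeter α T ∧ y ∈ sitePerimeter α T ∧ PixelAdj α.dual x y) := by
  simp [charGraph, Image.graph, blackImage]

theorem exists_sitePerimeter_subset_Icc (hT : T.Finite) :
    ∃ l u : Pixel, sitePerimeter α T ⊆ Set.Icc l u := by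
  obtain ⟨u, hu⟩ := hT.bddAbove
  obtain ⟨l, hl⟩ := hT.bddBelow
  refine ⟨(l.1 - 1, l.2 - 1), (u.1 + 1, u.2 + 1), ?_⟩
  rintro z ⟨-, t, ht, hzt⟩
  have htu := hu ht
  have hlt := hl ht
  have hzt8 := pixelAdj_eight_iff.1 hzt.eight
  simp only [Prod.le_def, Set.mem_Icc] at *
  omega

theorem reachable_of_forall_int {V : Type*} {G : SimpleGraph V} {f : ℤ → V}
    (h : ∀ a, G.Adj (f a) (f (a + 1))) (a b : ℤ) : G.Reachable (f a) (f b) := by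
  have key (a : ℤ) : G.Reachable (f 0) (f a) := by
    induction a using Int.induction_on with
    | zero => rfl
    | succ i ih => exact ih.trans (h _).reachable
    | pred i ih => exact ih.trans (by simpa using (h (-i - 1)).reachable.symm)
  exact (key a).symm.trans (key b)

theorem reachable_corner {l u : Pixel} (hP : sitePerimeter α T ⊆ Set.Icc l u) {z : Pixel}
    (hz : z ∉ Set.Icc l u) : (charGraph α T).Reachable z (u.1 + 1, u.2 + 1) := by
  have adj {p q : Pixel} (hp : p ∉ Set.Icc l u) (hq : q ∉ Set.Icc l u) (hpq : PixelAdj .four p q) :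
      (charGraph α T).Adj p q :=
    charGraph_adj.2 (Or.inl ⟨fun h => hp (hP h), fun h => hq (hP h), hpq.of_four⟩)
  have column (c : ℤ) (hc : c < l.1 ∨ u.1 < c) (y y' : ℤ) :
      (charGraph α T).Reachable (c, y) (c, y') := by
    have hc' (y : ℤ) : (c, y) ∉ Set.Icc l u := by
      simp only [Set.mem_Icc, Prod.le_def]
      omega
    exact reachable_of_forall_int (f := fun y => (c, y))
      (fun y => adj (hc' y) (hc' (y + 1)) (pixelAdj_four_iff.2 (by simp))) y y'
  have row (c : ℤ) (hc : c < l.2 ∨ u.2 < c) (x x' : ℤ) :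
      (charGraph α T).Reachable (x, c) (x', c) := by
    have hc' (x : ℤ) : (x, c) ∉ Set.Icc l u := by
      simp only [Set.mem_Icc, Prod.le_def]
      omega
    exact reachable_of_forall_int (f := fun x => (x, c))
      (fun x => adj (hc' x) (hc' (x + 1)) (pixelAdj_four_iff.2 (by simp))) x x'
  have hz' : (z.1 < l.1 ∨ u.1 < z.1) ∨ (z.2 < l.2 ∨ u.2 < z.2) := by
    simp only [Set.mem_Icc, Prod.le_def] at hz
    omega
  rcases hz' with h | h
  · exact (column _ h _ _).trans (row _ (Or.inr (lt_add_one u.2)) _ _)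
  · exact (row _ h _ _).trans (column _ (Or.inr (lt_add_one u.1)) _ _)

theorem mem_exterior_of_notMem_Icc {l u : Pixel} (hP : sitePerimeter α T ⊆ Set.Icc l u) {z : Pixel}
    (hz : z ∉ Set.Icc l u) : z ∈ exterior α T :=
  (Set.finite_Icc l u).infinite_compl.mono fun _ hw =>
    ConnectedComponent.eq.2 ((reachable_corner hP hw).trans (reachable_corner hP hz).symm)

theorem reachable_corner_of_mem_exterior {l u : Pixel} (hP : sitePerimeter α T ⊆ Set.Icc l u)
    {e : Pixel} (he : e ∈ exterior α T) : (charGraph α T).Reachable e (u.1 + 1, u.2 + 1) := by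
  obtain ⟨z, hz, hzB⟩ := he.exists_notMem_finite (Set.finite_Icc l u)
  exact (ConnectedComponent.eq.1 hz).symm.trans (reachable_corner hP hzB)

theorem mem_exterior_of_reachable {e z : Pixel} (he : e ∈ exterior α T)
    (h : (charGraph α T).Reachable e z) : z ∈ exterior α T := by
  rwa [exterior, Set.mem_ofPred_eq, ← ConnectedComponent.eq.2 h]

theorem notMem_exterior_of_forall_adj {S : Set Pixel} (hS : S.Finite)
    (h : ∀ a ∈ S, ∀ b, (charGraph α T).Adj a b → b ∈ S) {p : Pixel} (hp : p ∈ S) :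
    p ∉ exterior α T := by
  have mem_of_reachable (z : Pixel) (hz : (charGraph α T).Reachable p z) : z ∈ S := by
    rw [reachable_iff_reflTransGen] at hz
    induction hz with
    | refl => exact hp
    | tail _ hbc ih => exact h _ ih _ hbc
  exact fun he => he (hS.subset fun z hz => mem_of_reachable z (ConnectedComponent.eq.1 hz).symm)

theorem sitePerimeter_finite (hT : T.Finite) : (sitePerimeter α T).Finite := by
  obtain ⟨l, u, hP⟩ := exists_sitePerimeter_subset_Icc (α := α) hT
  exact (Set.finite_Icc l u).subset hP

theorem notMem_exterior_of_mem_sitePerimeter (hT : T.Finite) {p : Pixel}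
    (hp : p ∈ sitePerimeter α T) : p ∉ exterior α T :=
  notMem_exterior_of_forall_adj (sitePerimeter_finite hT)
    (fun _ ha _ hab => (charGraph_adj.1 hab).elim (fun h => absurd ha h.1) fun h => h.2.1) hp

theorem notMem_exterior_of_mem (hT : T.Finite) {t : Pixel} (ht : t ∈ T) : t ∉ exterior α T :=
  notMem_exterior_of_forall_adj hT
    (fun a ha _ hab => (charGraph_adj.1 hab).elim
      (fun h => by_contra fun hb => h.2.1 ⟨hb, a, ha, h.2.2.symm⟩)
      fun h => absurd ha h.1.1) ht

theorem exterior_compl_finite (hT : T.Finite) : (exterior α T)ᶜ.Finite := by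
  obtain ⟨l, u, hP⟩ := exists_sitePerimeter_subset_Icc (α := α) hT
  exact (Set.finite_Icc l u).subset fun z hz =>
    by_contra fun h => hz (mem_exterior_of_notMem_Icc hP h)

theorem exterior_infinite (hT : T.Finite) : (exterior α T).Infinite := fun h =>
  h.infinite_compl (exterior_compl_finite hT)

/-- The pixels that are neither in the exterior nor on the exterior site perimeter. They turn out to
be the interior pixels. -/
def inner (α : Connectivity) (T : Set Pixel) : Set Pixel := (exterior α T ∪ extPerimeter α T)ᶜ

theorem middle_inner (hT : T.Finite) : middle (exterior α T) (inner α T) = extPerimeter α T := by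
  ext q
  have : q ∈ extPerimeter α T → q ∉ exterior α T := fun h =>
    notMem_exterior_of_mem_sitePerimeter hT h.1
  simp only [middle, inner, Set.mem_ofPred_eq, Set.mem_compl_iff, Set.mem_union]
  tauto

theorem subset_inner (hT : T.Finite) : T ⊆ inner α T := fun _ ht h =>
  h.elim (notMem_exterior_of_mem hT ht) fun h => h.1.1 ht

theorem mem_inner_of_notMem_sitePerimeter {z : Pixel} (hP : z ∉ sitePerimeter α T)
    (hE : z ∉ exterior α T) : z ∈ inner α T := fun h => h.elim hE fun h => hP h.1

theorem not_pixelAdj_inner_exterior (hT : T.Finite) {n e : Pixel} (hn : n ∈ inner α T)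
    (he : e ∈ exterior α T) : ¬ PixelAdj α n e := by
  intro hne
  by_cases hP : n ∈ sitePerimeter α T
  · exact hn (Or.inr ⟨hP, e, he, hne⟩)
  · have hen : (charGraph α T).Adj e n := charGraph_adj.2 <|
      Or.inl ⟨fun h => notMem_exterior_of_mem_sitePerimeter hT h he, hP, hne.symm⟩
    exact hn (Or.inl (mem_exterior_of_reachable he hen.reachable))

theorem exterior_connected (hT : T.Finite) {e e' : Pixel} (he : e ∈ exterior α T)
    (he' : e' ∈ exterior α T) :
    ReflTransGen (fun a b => a ∈ exterior α T ∧ b ∈ exterior α T ∧ PixelAdj α a b) e e' := by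
  obtain ⟨l, u, hP⟩ := exists_sitePerimeter_subset_Icc (α := α) hT
  have h := (reachable_corner_of_mem_exterior hP he).trans
    (reachable_corner_of_mem_exterior hP he').symm
  rw [reachable_iff_reflTransGen] at h
  clear he'
  induction h with
  | refl => rfl
  | @tail b c hab hbc ih =>
    have hb := mem_exterior_of_reachable he ((reachable_iff_reflTransGen _ _).2 hab)
    refine ih.tail ⟨hb, mem_exterior_of_reachable hb hbc.reachable, ?_⟩
    exact (charGraph_adj.1 hbc).elim (fun h => h.2.2)
      fun h => absurd hb (notMem_exterior_of_mem_sitePerimeter hT h.1)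

theorem exists_adj_notMem_ne {F : Set Pixel} (hF : F.Finite) (hne : F.Nonempty) (q q' : Pixel) :
    ∃ f ∈ F, ∃ p ∉ F ∪ {q, q'}, PixelAdj .four f p := by
  obtain ⟨a, ha, hamax⟩ := Set.exists_max_image F (fun z => z.1) hF hne
  obtain ⟨b, hb, hbmin⟩ := Set.exists_min_image F (fun z => z.1) hF hne
  obtain ⟨c, hc, hcmax⟩ := Set.exists_max_image F (fun z => z.2) hF hne
  have right : (a.1 + 1, a.2) ∉ F := fun h => by simpa using hamax _ h
  have left : (b.1 - 1, b.2) ∉ F := fun h => by simpa using hbmin _ h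
  have top : (c.1, c.2 + 1) ∉ F := fun h => by simpa using hcmax _ h
  have hab := hamax b hb
  have hac := hamax c hc
  have hbc := hbmin c hc
  by_contra! hcon
  have eq_or_eq {f p : Pixel} (hf : f ∈ F) (hfp : PixelAdj .four f p) (hp : p ∉ F) :
      p = q ∨ p = q' := by
    by_contra hpq
    exact hcon f hf p (not_or.2 ⟨hp, hpq⟩) hfp
  have hr := eq_or_eq ha (pixelAdj_four_iff.2 (by simp)) right
  have hl := eq_or_eq hb (pixelAdj_four_iff.2 (by simp)) left
  have ht := eq_or_eq hc (pixelAdj_four_iff.2 (by simp)) top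
  simp only [Prod.ext_iff] at hr hl ht
  omega

theorem exists_innerStep_of_mem_sitePerimeter (hT : T.Finite) {K : Set Pixel} (hK : inner α T ⊆ K)
    {p : Pixel} (hp : p ∈ sitePerimeter α T) (hpK : p ∈ K) :
    ∃ t ∈ T, InnerStep α (inner α T) K p t := by
  obtain ⟨t, ht, hpt⟩ := hp.2
  have htN := subset_inner (α := α) hT ht
  exact ⟨t, ht, hpt, hpK, hK htN, Or.inr htN⟩

theorem reflTransGen_innerStep_of_reachable {K : Set Pixel} (hK : inner α T ⊆ K) {k f : Pixel}
    (hk : k ∉ exterior α T) (hkP : k ∉ sitePerimeter α T) (h : (charGraph α T).Reachable k f) :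
    f ∈ inner α T ∧ f ∉ sitePerimeter α T ∧ ReflTransGen (InnerStep α (inner α T) K) k f := by
  rw [reachable_iff_reflTransGen] at h
  induction h with
  | refl => exact ⟨mem_inner_of_notMem_sitePerimeter hkP hk, hkP, .refl⟩
  | @tail b c _ hbc ih =>
    obtain ⟨hb, hbP, hkb'⟩ := ih
    rcases charGraph_adj.1 hbc with ⟨-, hcP, hadj⟩ | ⟨hbP', -, -⟩
    · have hcE : c ∉ exterior α T := fun hc =>
        hb (Or.inl (mem_exterior_of_reachable hc hbc.symm.reachable))
      have hc := mem_inner_of_notMem_sitePerimeter hcP hcE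
      exact ⟨hc, hcP, hkb'.tail ⟨hadj, hK hb, hK hc, Or.inl hb⟩⟩
    · exact absurd hbP' hbP

theorem exists_reflTransGen_innerStep (hT : T.Finite) {q q' k : Pixel}
    (hN : inner α T ⊆ (exterior α T ∪ {q, q'})ᶜ) (hk : k ∉ exterior α T ∪ {q, q'}) :
    ∃ t ∈ T, ReflTransGen (InnerStep α (inner α T) (exterior α T ∪ {q, q'})ᶜ) k t := by
  by_cases hkP : k ∈ sitePerimeter α T
  · obtain ⟨t, ht, hkt⟩ := exists_innerStep_of_mem_sitePerimeter hT hN hkP hk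
    exact ⟨t, ht, .single hkt⟩
  have hkE : k ∉ exterior α T := fun h => hk (Or.inl h)
  -- The component of `k` is finite, hence has a neighbour `p` other than `q` and `q'`.
  obtain ⟨f, hf, p, hp, hfp⟩ := exists_adj_notMem_ne (Set.not_infinite.1 hkE)
    (ConnectedComponent.nonempty_supp _) q q'
  obtain ⟨hfN, hfP, hkf⟩ :=
    reflTransGen_innerStep_of_reachable hN hkE hkP (ConnectedComponent.eq.1 hf).symm
  have hpP : p ∈ sitePerimeter α T := by
    by_contra hpP
    refine hp (Or.inl ((ConnectedComponent.mem_supp_congr_adj _ ?_).1 hf))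
    exact charGraph_adj.2 (Or.inl ⟨hfP, hpP, hfp.of_four⟩)
  have hpK : p ∉ exterior α T ∪ {q, q'} := fun h =>
    h.elim (notMem_exterior_of_mem_sitePerimeter hT hpP) fun h => hp (Or.inr h)
  obtain ⟨t, ht, hpt⟩ := exists_innerStep_of_mem_sitePerimeter hT hN hpP hpK
  exact ⟨t, ht, (hkf.tail ⟨hfp.of_four, hN hfN, hpK, Or.inl hfN⟩).tail hpt⟩

theorem IsComponent.reflTransGen (hT : IsComponent α T) {t t' : Pixel} (ht : t ∈ T) (ht' : t' ∈ T) :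
    ReflTransGen (fun a b => a ∈ T ∧ b ∈ T ∧ PixelAdj α a b) t t' := by
  have h := hT.2.preconnected ⟨t, ht⟩ ⟨t', ht'⟩
  rw [reachable_iff_reflTransGen] at h
  exact h.lift (p := fun a b => a ∈ T ∧ b ∈ T ∧ PixelAdj α a b) Subtype.val
    fun a b hab => ⟨a.2, b.2, hab⟩

theorem IsComponent.reflTransGen_innerStep (hT : IsComponent α T) {q q' : Pixel}
    (hq : q ∈ extPerimeter α T) (hq' : q' ∈ extPerimeter α T) {k k' : Pixel}
    (hk : k ∉ exterior α T ∪ {q, q'}) (hk' : k' ∉ exterior α T ∪ {q, q'}) :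
    ReflTransGen (InnerStep α (inner α T) (exterior α T ∪ {q, q'})ᶜ) k k' := by
  have hN : inner α T ⊆ (exterior α T ∪ {q, q'})ᶜ := by
    rintro n hn (hE | rfl | rfl)
    exacts [hn (Or.inl hE), hn (Or.inr hq), hn (Or.inr hq')]
  obtain ⟨t, ht, hkt⟩ := exists_reflTransGen_innerStep hT.1 hN hk
  obtain ⟨t', ht', hkt'⟩ := exists_reflTransGen_innerStep hT.1 hN hk'
  have htt' := (hT.reflTransGen ht ht').lift (p := InnerStep α (inner α T)
    (exterior α T ∪ {q, q'})ᶜ) id fun a b hab => by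
      have ha := subset_inner (α := α) hT.1 hab.1
      exact ⟨hab.2.2, hN ha, hN (subset_inner hT.1 hab.2.1), Or.inl ha⟩
  exact (hkt.trans htt').trans <| hkt'.swap.lift id
    fun _ _ hab => ⟨hab.1.symm, hab.2.2.1, hab.2.1, hab.2.2.2.symm⟩

theorem IsComponent.separation (hT : IsComponent α T) :
    Separation α (exterior α T) (inner α T) where
  disjoint := Set.disjoint_left.2 fun _ he hn => hn (Or.inl he)
  not_adj _ hn _ he := not_pixelAdj_inner_exterior hT.1 hn he
  exists_exterior q hq := ((middle_inner hT.1).subset hq).2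
  exists_inner q hq :=
    let ⟨t, ht, hqt⟩ := ((middle_inner hT.1).subset hq).1.2
    ⟨t, subset_inner hT.1 ht, hqt⟩
  connected _ he _ he' := exterior_connected hT.1 he he'
  compl_connected q hq q' hq' _ hk _ hk' := by
    rw [middle_inner hT.1] at hq hq'
    exact hT.reflTransGen_innerStep hq hq' hk hk'

theorem extPerimeter_adj_iff {u v : Pixel} (hu : u ∈ extPerimeter α T) (hv : v ∈ extPerimeter α T) :
    (charGraph α T).Adj u v ↔ PixelAdj α.dual u v := by
  simp [charGraph_adj, hu.1, hv.1]

end CharGraph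

/-! ### The metrics of the plane -/

section GridDist

variable {α : Connectivity}

theorem gridDist_comm (α : Connectivity) (x y : ℝ × ℝ) : gridDist α x y = gridDist α y x := by
  cases α <;> simp only [gridDist, abs_sub_comm]

theorem gridDist_triangle (α : Connectivity) (x y z : ℝ × ℝ) :
    gridDist α x z ≤ gridDist α x y + gridDist α y z := by
  cases α
  · have h₁ := abs_sub_le x.1 y.1 z.1
    have h₂ := abs_sub_le x.2 y.2 z.2
    simp only [gridDist]
    linarith
  · exact dist_triangle x y z

theorem dist_le_gridDist (α : Connectivity) (x y : ℝ × ℝ) : dist x y ≤ gridDist α x y := by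
  cases α
  · exact max_le_add_of_nonneg (abs_nonneg _) (abs_nonneg _)
  · exact le_rfl

theorem gridDist_nonneg (α : Connectivity) (x y : ℝ × ℝ) : 0 ≤ gridDist α x y :=
  dist_nonneg.trans (dist_le_gridDist α x y)

theorem gridDist_self (α : Connectivity) (x : ℝ × ℝ) : gridDist α x x = 0 := by
  cases α <;> simp [gridDist]

theorem gridDist_of_fst_eq (α : Connectivity) {x y : ℝ × ℝ} (h : x.1 = y.1) :
    gridDist α x y = |x.2 - y.2| := by
  cases α <;> simp [gridDist, h]

theorem gridDist_of_snd_eq (α : Connectivity) {x y : ℝ × ℝ} (h : x.2 = y.2) :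
    gridDist α x y = |x.1 - y.1| := by
  cases α <;> simp [gridDist, h]

theorem gridDist_swap (α : Connectivity) (x : ℝ × ℝ) (z : Pixel) :
    gridDist α x.swap (toPlane z.swap) = gridDist α x (toPlane z) := by
  cases α
  · exact add_comm _ _
  · exact max_comm _ _

theorem continuous_gridDist (α : Connectivity) (x : ℝ × ℝ) : Continuous (gridDist α x) := by
  cases α
  · exact (by fun_prop : Continuous fun y : ℝ × ℝ => |x.1 - y.1| + |x.2 - y.2|)
  · exact continuous_const.dist continuous_id

theorem gridDist_add_of_mem_segment (α : Connectivity) {x y z : ℝ × ℝ} (h : y ∈ segment ℝ x z) :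
    gridDist α x y + gridDist α y z = gridDist α x z := by
  obtain ⟨s, t, hs, ht, hst, rfl⟩ := h
  obtain rfl : s = 1 - t := by linarith
  have left (a b : ℝ) : |a - ((1 - t) * a + t * b)| = t * |a - b| := by
    rw [show a - ((1 - t) * a + t * b) = t * (a - b) by ring, abs_mul, abs_of_nonneg ht]
  have right (a b : ℝ) : |(1 - t) * a + t * b - b| = (1 - t) * |a - b| := by
    rw [show (1 - t) * a + t * b - b = (1 - t) * (a - b) by ring, abs_mul, abs_of_nonneg hs]
  cases α <;> simp only [gridDist, Prod.fst_add, Prod.snd_add, Prod.smul_fst, Prod.smul_snd,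
    smul_eq_mul, left, right]
  · ring
  · rw [← mul_max_of_nonneg _ _ ht, ← mul_max_of_nonneg _ _ hs]
    ring

theorem mem_segment_toPlane {u v : Pixel} {x : ℝ × ℝ} :
    x ∈ segment ℝ (toPlane u) (toPlane v) ↔ ∃ t ∈ Set.Icc (0 : ℝ) 1,
      x.1 = u.1 + t * (v.1 - u.1) ∧ x.2 = u.2 + t * (v.2 - u.2) := by
  simp [segment_eq_image', toPlane, Prod.ext_iff, eq_comm]

theorem toPlane_injective : Function.Injective toPlane :=
  Int.cast_injective.prodMap Int.cast_injective

theorem exists_gridDist_eq_intCast (α : Connectivity) (a b : Pixel) :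
    ∃ m : ℤ, gridDist α (toPlane a) (toPlane b) = m := by
  cases α
  · exact ⟨|a.1 - b.1| + |a.2 - b.2|, by simp [gridDist, toPlane]⟩
  · exact ⟨max |a.1 - b.1| |a.2 - b.2|, by simp [gridDist, toPlane]⟩

theorem one_le_gridDist {a b : Pixel} (h : a ≠ b) : 1 ≤ gridDist α (toPlane a) (toPlane b) := by
  have hpos := (dist_pos.2 (toPlane_injective.ne h)).trans_le (dist_le_gridDist α _ _)
  obtain ⟨m, hm⟩ := exists_gridDist_eq_intCast α a b
  rw [hm] at hpos ⊢
  exact_mod_cast hpos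

theorem two_le_gridDist {a b : Pixel} (h : a ≠ b) (h' : ¬ PixelAdj α a b) :
    2 ≤ gridDist α (toPlane a) (toPlane b) := by
  have hlt := lt_of_le_of_ne (one_le_gridDist h) (Ne.symm h')
  obtain ⟨m, hm⟩ := exists_gridDist_eq_intCast α a b
  rw [hm] at hlt ⊢
  exact_mod_cast hlt

theorem exists_gridDist_le_one (α : Connectivity) (x : ℝ × ℝ) :
    ∃ z : Pixel, gridDist α x (toPlane z) ≤ 1 := by
  refine ⟨(round x.1, round x.2), ?_⟩
  have h₁ := abs_sub_round x.1
  have h₂ := abs_sub_round x.2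
  cases α
  · exact (add_le_add h₁ h₂).trans (by norm_num)
  · exact max_le (h₁.trans (by norm_num)) (h₂.trans (by norm_num))

theorem finite_preimage_toPlane {S : Set (ℝ × ℝ)} (hS : Bornology.IsBounded S) :
    (toPlane ⁻¹' S).Finite := by
  have h : Filter.Tendsto toPlane Filter.cofinite (Bornology.cobounded (ℝ × ℝ)) := by
    rw [Metric.cobounded_eq_cocompact, ← Filter.coprod_cofinite, ← Filter.coprod_cocompact]
    exact Int.tendsto_coe_cofinite.prodMap_coprod Int.tendsto_coe_cofinite
  simpa [Set.preimage_compl] using h (Bornology.isBounded_def.1 hS)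

theorem exists_nearest (α : Connectivity) (x : ℝ × ℝ) {S : Set Pixel} (hS : S.Nonempty) :
    ∃ z ∈ S, ∀ w ∈ S, gridDist α x (toPlane z) ≤ gridDist α x (toPlane w) := by
  obtain ⟨z₀, hz₀⟩ := hS
  have hfin : {z ∈ S | gridDist α x (toPlane z) ≤ gridDist α x (toPlane z₀)}.Finite :=
    (finite_preimage_toPlane Metric.isBounded_closedBall).subset fun z hz =>
      Metric.mem_closedBall'.2 ((dist_le_gridDist α x _).trans hz.2)
  obtain ⟨z, hz, hmin⟩ := Set.exists_min_image _ (fun z => gridDist α x (toPlane z)) hfin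
    ⟨z₀, hz₀, le_rfl⟩
  refine ⟨z, hz.1, fun w hw => ?_⟩
  by_cases h : gridDist α x (toPlane w) ≤ gridDist α x (toPlane z₀)
  · exact hmin w ⟨hw, h⟩
  · exact hz.2.trans (not_le.1 h).le

end GridDist

/-! ### Points closer to one set of pixels than to another -/

section Closer

/-- The points of the plane that are closer to `A` than to `B`, in a form that involves no infimum:
some pixel of `A` beats every pixel of `B`. -/
def closer (α : Connectivity) (A B : Set Pixel) : Set (ℝ × ℝ) :=
  {x | ∃ a ∈ A, ∀ b ∈ B, gridDist α x (toPlane a) < gridDist α x (toPlane b)}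

variable {α : Connectivity} {A B : Set Pixel}

theorem distTo_lt_distTo_iff {x : ℝ × ℝ} :
    distTo α x A < distTo α x B ↔ x ∈ closer α A B := by
  constructor
  · intro h
    simp only [distTo, iInf_lt_iff] at h
    obtain ⟨a, ha, hab⟩ := h
    refine ⟨a, ha, fun b hb => ?_⟩
    exact lt_of_not_ge fun hle =>
      (hab.trans_le (iInf₂_le b hb)).not_ge (ENNReal.ofReal_le_ofReal hle)
  · rintro ⟨a, ha, hab⟩
    have hxA : distTo α x A ≤ ENNReal.ofReal (gridDist α x (toPlane a)) := iInf₂_le a ha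
    rcases B.eq_empty_or_nonempty with rfl | hB
    · exact hxA.trans_lt (by simp [distTo])
    · obtain ⟨b, hb, hmin⟩ := exists_nearest α x hB
      calc distTo α x A ≤ ENNReal.ofReal (gridDist α x (toPlane a)) := hxA
        _ < ENNReal.ofReal (gridDist α x (toPlane b)) :=
          (ENNReal.ofReal_lt_ofReal_iff_of_nonneg (gridDist_nonneg _ _ _)).2 (hab b hb)
        _ ≤ distTo α x B := le_iInf₂ fun w hw => ENNReal.ofReal_le_ofReal (hmin w hw)

theorem isOpen_closer (α : Connectivity) (A : Set Pixel) (hB : B.Nonempty) :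
    IsOpen (closer α A B) := by
  rw [isOpen_iff_mem_nhds]
  rintro x ⟨a, ha, hab⟩
  obtain ⟨b, hb, hmin⟩ := exists_nearest α x hB
  have hgap := hab b hb
  have hnear : ∀ᶠ y in nhds x, gridDist α x y <
      (gridDist α x (toPlane b) - gridDist α x (toPlane a)) / 2 :=
    (continuous_gridDist α x).continuousAt.eventually_lt continuousAt_const
      (by rw [gridDist_self]; linarith)
  filter_upwards [hnear] with y hy
  refine ⟨a, ha, fun w hw => ?_⟩
  have hxw := gridDist_triangle α x y (toPlane w)
  have hya := gridDist_triangle α y x (toPlane a)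
  rw [gridDist_comm α y x] at hya
  linarith [hmin w hw]

theorem disjoint_closer (α : Connectivity) (A B : Set Pixel) :
    Disjoint (closer α A B) (closer α B A) := by
  rw [Set.disjoint_left]
  rintro x ⟨a, ha, hab⟩ ⟨b, hb, hba⟩
  exact lt_asymm (hab b hb) (hba a ha)

theorem swap_mem_closer {x : ℝ × ℝ} (hx : x ∈ closer α A B) :
    x.swap ∈ closer α (Prod.swap ⁻¹' A) (Prod.swap ⁻¹' B) := by
  obtain ⟨a, ha, hab⟩ := hx
  refine ⟨a.swap, by simpa using ha, fun b hb => ?_⟩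
  rw [gridDist_swap, ← b.swap_swap, gridDist_swap]
  exact hab _ hb

theorem mem_closer_of_lt_one (h : Disjoint A B) (h' : ∀ a ∈ A, ∀ b ∈ B, ¬ PixelAdj α a b)
    {x : ℝ × ℝ} {a : Pixel} (ha : a ∈ A) (hx : gridDist α x (toPlane a) < 1) :
    x ∈ closer α A B := by
  refine ⟨a, ha, fun b hb => ?_⟩
  have hab := two_le_gridDist (h.ne_of_mem ha hb) (h' a ha b hb)
  have htri := gridDist_triangle α (toPlane a) x (toPlane b)
  rw [gridDist_comm α (toPlane a) x] at htri
  linarith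

theorem segment_subset_closer {x : ℝ × ℝ} {a : Pixel} (ha : a ∈ A)
    (hx : ∀ b ∈ B, gridDist α x (toPlane a) < gridDist α x (toPlane b)) :
    segment ℝ x (toPlane a) ⊆ closer α A B := by
  intro y hy
  refine ⟨a, ha, fun b hb => ?_⟩
  have hxa := gridDist_add_of_mem_segment α hy
  have hxb := gridDist_triangle α x y (toPlane b)
  linarith [hx b hb]

theorem segment_adj_subset_closer (h : Disjoint A B) (h' : ∀ a ∈ A, ∀ b ∈ B, ¬ PixelAdj α a b)
    {a a' : Pixel} (ha : a ∈ A) (ha' : a' ∈ A) (hadj : PixelAdj α a a') :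
    segment ℝ (toPlane a) (toPlane a') ⊆ closer α A B := by
  intro y hy
  have hsum := gridDist_add_of_mem_segment α hy
  rw [hadj, gridDist_comm α (toPlane a) y] at hsum
  by_cases hlt : gridDist α y (toPlane a) < 1
  · exact mem_closer_of_lt_one h h' ha hlt
  · exact mem_closer_of_lt_one h h' ha' (by linarith)

theorem isPathConnected_closer (h : Disjoint A B) (h' : ∀ a ∈ A, ∀ b ∈ B, ¬ PixelAdj α a b)
    (hA : A.Nonempty) (hconn : ∀ a ∈ A, ∀ a' ∈ A,
      Relation.ReflTransGen (fun a b => a ∈ A ∧ b ∈ A ∧ PixelAdj α a b) a a') :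
    IsPathConnected (closer α A B) := by
  obtain ⟨a₀, ha₀⟩ := hA
  have hmem : toPlane a₀ ∈ closer α A B :=
    mem_closer_of_lt_one h h' ha₀ (by rw [gridDist_self]; exact one_pos)
  have hjoin {a : Pixel}
      (hpath : Relation.ReflTransGen (fun a b => a ∈ A ∧ b ∈ A ∧ PixelAdj α a b) a₀ a) :
      JoinedIn (closer α A B) (toPlane a₀) (toPlane a) := by
    induction hpath with
    | refl => exact JoinedIn.refl hmem
    | tail _ hbc ih =>
      obtain ⟨hb, hc, hbc⟩ := hbc
      exact ih.trans (JoinedIn.of_segment_subset (segment_adj_subset_closer h h' hb hc hbc))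
  refine ⟨toPlane a₀, hmem, ?_⟩
  rintro y ⟨a, ha, hab⟩
  exact (hjoin (hconn a₀ ha₀ a ha)).trans
    (JoinedIn.of_segment_subset (segment_subset_closer ha hab)).symm

theorem isBounded_closer (h : Disjoint A B) (hB : Bᶜ.Finite) :
    Bornology.IsBounded (closer α A B) := by
  refine ((Bornology.isBounded_biUnion hB).2 fun z _ =>
    Metric.isBounded_closedBall (x := toPlane z) (r := 1)).subset ?_
  rintro x ⟨a, ha, hab⟩
  obtain ⟨z, hz, hxz⟩ : ∃ z ∉ B, gridDist α x (toPlane z) ≤ 1 := by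
    obtain ⟨z, hxz⟩ := exists_gridDist_le_one α x
    by_cases hz : z ∈ B
    · exact ⟨a, h.notMem_of_mem_left ha, (hab z hz).le.trans hxz⟩
    · exact ⟨z, hz, hxz⟩
  exact Set.mem_biUnion hz (Metric.mem_closedBall.2 ((dist_le_gridDist α x _).trans hxz))

theorem not_isBounded_closer (h : Disjoint A B) (h' : ∀ a ∈ A, ∀ b ∈ B, ¬ PixelAdj α a b)
    (hA : A.Infinite) : ¬ Bornology.IsBounded (closer α A B) := fun hb =>
  hA <| (finite_preimage_toPlane hb).subset fun _ ha =>
    mem_closer_of_lt_one h h' ha (by rw [gridDist_self]; exact one_pos)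

/-- The points that are closer to neither of `E` and `N`. -/
def equidistant (α : Connectivity) (E N : Set Pixel) : Set (ℝ × ℝ) :=
  (closer α N E ∪ closer α E N)ᶜ

theorem mem_equidistant_iff {E N : Set Pixel} {x : ℝ × ℝ} : x ∈ equidistant α E N ↔
    (∀ n ∈ N, ∃ e ∈ E, gridDist α x (toPlane e) ≤ gridDist α x (toPlane n)) ∧
      ∀ e ∈ E, ∃ n ∈ N, gridDist α x (toPlane n) ≤ gridDist α x (toPlane e) := by
  simp [equidistant, closer]

end Closer

/-! ### Distances in a unit cell -/

section Cell

variable {A B : Set Pixel} {x : ℝ × ℝ} {i j : ℤ}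

/-- The corners of the unit cell `[i, i + 1] × [j, j + 1]`. -/
def corners (i j : ℤ) : Set Pixel := {i, i + 1} ×ˢ {j, j + 1}

theorem exists_endpoint {s : ℝ} (hs : s ∈ Set.Icc (i : ℝ) (i + 1)) (z : ℤ) :
    ∃ c ∈ ({i, i + 1} : Set ℤ), |s - z| = |s - c| + |(c : ℝ) - z| := by
  obtain ⟨h, h'⟩ := hs
  rcases le_or_gt z i with hz | hz
  · have hz : (z : ℝ) ≤ i := by exact_mod_cast hz
    refine ⟨i, by simp, ?_⟩
    rw [abs_of_nonneg, abs_of_nonneg, abs_of_nonneg] <;> linarith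
  · have hz : (i : ℝ) + 1 ≤ z := by exact_mod_cast hz
    refine ⟨i + 1, by simp, ?_⟩
    push_cast
    rw [abs_of_nonpos, abs_of_nonpos, abs_of_nonpos] <;> linarith

theorem abs_sub_endpoint_le_one {s : ℝ} (hs : s ∈ Set.Icc (i : ℝ) (i + 1)) {c : ℤ}
    (hc : c ∈ ({i, i + 1} : Set ℤ)) : |s - c| ≤ 1 := by
  obtain ⟨h, h'⟩ := hs
  rcases hc with rfl | rfl <;> push_cast <;> rw [abs_le] <;> constructor <;> linarith

theorem exists_other_endpoint {s : ℝ} (hs : s ∈ Set.Ioo (i : ℝ) (i + 1)) {c : ℤ}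
    (hc : c ∈ ({i, i + 1} : Set ℤ)) :
    ∃ c' ∈ ({i, i + 1} : Set ℤ), (c' = c + 1 ∨ c' = c - 1) ∧ |s - c'| < 1 := by
  obtain ⟨h, h'⟩ := hs
  rcases hc with rfl | rfl
  · refine ⟨c + 1, by simp, by simp, ?_⟩
    push_cast
    rw [abs_lt]
    constructor <;> linarith
  · refine ⟨i, by simp, by simp, ?_⟩
    rw [abs_lt]
    constructor <;> linarith

theorem eq_add_abs_sub_mul {s : ℝ} (hs : s ∈ Set.Icc (i : ℝ) (i + 1)) {c c' : ℤ}
    (hc : c ∈ ({i, i + 1} : Set ℤ)) (hc' : c' ∈ ({i, i + 1} : Set ℤ)) (hcc' : c ≠ c') :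
    s = c + |s - c| * (c' - c) ∧ |s - c| + |s - c'| = 1 := by
  obtain ⟨h, h'⟩ := hs
  have hi : |s - i| = s - i := abs_of_nonneg (by linarith)
  have hi' : |s - (i + 1)| = i + 1 - s := by rw [abs_of_nonpos (by linarith)]; ring
  rcases hc with rfl | rfl <;> rcases hc' with rfl | rfl <;>
    first | exact absurd rfl hcc' | (push_cast; rw [hi, hi']; constructor <;> ring)

theorem exists_corner (hx₁ : x.1 ∈ Set.Icc (i : ℝ) (i + 1)) (hx₂ : x.2 ∈ Set.Icc (j : ℝ) (j + 1))
    (z : Pixel) : ∃ c ∈ corners i j,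
      gridDist .four x (toPlane z) =
        gridDist .four x (toPlane c) + gridDist .four (toPlane c) (toPlane z) := by
  obtain ⟨c, hc, hxc⟩ := exists_endpoint hx₁ z.1
  obtain ⟨d, hd, hxd⟩ := exists_endpoint hx₂ z.2
  refine ⟨(c, d), ⟨hc, hd⟩, ?_⟩
  simp only [gridDist, toPlane]
  rw [hxc, hxd]
  ring

theorem one_le_gridDist_of_notMem_corners (hx₁ : x.1 ∈ Set.Icc (i : ℝ) (i + 1))
    (hx₂ : x.2 ∈ Set.Icc (j : ℝ) (j + 1)) {z : Pixel} (hz : z ∉ corners i j) :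
    1 ≤ gridDist .four x (toPlane z) := by
  obtain ⟨c, hc, hxz⟩ := exists_corner hx₁ hx₂ z
  have hcz := one_le_gridDist (α := .four) (ne_of_mem_of_not_mem hc hz)
  linarith [gridDist_nonneg .four x (toPlane c)]

theorem mem_closer_of_forall_corner (hx₁ : x.1 ∈ Set.Icc (i : ℝ) (i + 1))
    (hx₂ : x.2 ∈ Set.Icc (j : ℝ) (j + 1)) (hB : ∀ c ∈ corners i j, c ∉ B)
    (hA : ∀ c ∈ corners i j,
      ∃ a ∈ A, gridDist .four x (toPlane a) < gridDist .four x (toPlane c) + 1) :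
    x ∈ closer .four A B := by
  have hne : A.Nonempty :=
    let ⟨a, ha, _⟩ := hA (i, j) (by simp [corners])
    ⟨a, ha⟩
  obtain ⟨a, ha, hmin⟩ := exists_nearest .four x hne
  refine ⟨a, ha, fun b hb => ?_⟩
  obtain ⟨c, hc, hxb⟩ := exists_corner hx₁ hx₂ b
  obtain ⟨a', ha', hxa'⟩ := hA c hc
  have hcb := one_le_gridDist (α := .four) (ne_of_mem_of_not_mem hb (hB c hc)).symm
  linarith [hmin a' ha']

theorem exists_corner_mem_of_notMem_closer (hx₁ : x.1 ∈ Set.Ioo (i : ℝ) (i + 1))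
    (hx₂ : x.2 ∈ Set.Ioo (j : ℝ) (j + 1)) (hx : x ∉ closer .four A B)
    (hAB : ∀ c c' d d', (c' = c + 1 ∨ c' = c - 1) → (d' = d + 1 ∨ d' = d - 1) →
      (c, d) ∈ middle A B → (c', d) ∈ middle A B → (c, d') ∉ middle A B) :
    ∃ c ∈ corners i j, c ∈ B := by
  by_contra! hB
  refine hx (mem_closer_of_forall_corner (Set.Ioo_subset_Icc_self hx₁)
    (Set.Ioo_subset_Icc_self hx₂) hB ?_)
  rintro ⟨c, d⟩ ⟨hc, hd⟩
  obtain ⟨c', hc', hcc', hxc'⟩ := exists_other_endpoint hx₁ hc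
  obtain ⟨d', hd', hdd', hxd'⟩ := exists_other_endpoint hx₂ hd
  have hxc := abs_nonneg (x.1 - c)
  have hxd := abs_nonneg (x.2 - d)
  by_contra! hA
  simp only [gridDist] at hA
  refine hAB c c' d d' hcc' hdd' ⟨fun h => ?_, hB _ ⟨hc, hd⟩⟩ ⟨fun h => ?_, hB _ ⟨hc', hd⟩⟩
    ⟨fun h => ?_, hB _ ⟨hc, hd'⟩⟩ <;> have := hA _ h <;> simp only [toPlane] at this <;> linarith

theorem exists_endpoint_gridDist_four_le (hx₁ : x.1 ∈ Set.Icc (i : ℝ) (i + 1)) (hx₂ : x.2 = j)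
    {z : Pixel} (hz : z ≠ (i, j)) (hz' : z ≠ (i + 1, j)) :
    ∃ c ∈ ({i, i + 1} : Set ℤ), ∀ k, (k = j + 1 ∨ k = j - 1) →
      gridDist .four x (toPlane (c, k)) ≤ gridDist .four x (toPlane z) := by
  obtain ⟨c, hc, hxz⟩ := exists_endpoint hx₁ z.1
  have hcz : (c, j) ≠ z := by rcases hc with rfl | rfl <;> exact Ne.symm ‹_›
  have hone := one_le_gridDist (α := .four) hcz
  refine ⟨c, hc, fun k hk => ?_⟩
  have hjk : |(j : ℝ) - k| = 1 := by rcases hk with rfl | rfl <;> simp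
  simp only [gridDist, toPlane, hx₂] at hone ⊢
  linarith

theorem gridDist_eight_le_of_edge (hx₁ : x.1 ∈ Set.Icc (i : ℝ) (i + 1)) (hx₂ : x.2 = j)
    {z : Pixel} (hz : z ≠ (i, j)) (hz' : z ≠ (i + 1, j)) {c k : ℤ}
    (hc : c ∈ ({i, i + 1} : Set ℤ)) (hk : k = j + 1 ∨ k = j - 1) :
    gridDist .eight x (toPlane (c, k)) ≤ gridDist .eight x (toPlane z) := by
  obtain ⟨c', hc', hxz⟩ := exists_endpoint hx₁ z.1
  have hcz : (c', j) ≠ z := by rcases hc' with rfl | rfl <;> exact Ne.symm ‹_›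
  have hjk : |x.2 - k| = 1 := by rcases hk with rfl | rfl <;> simp [hx₂]
  calc gridDist .eight x (toPlane (c, k)) ≤ 1 :=
        max_le (abs_sub_endpoint_le_one hx₁ hc) hjk.le
    _ ≤ gridDist .eight (toPlane (c', j)) (toPlane z) := one_le_gridDist hcz
    _ ≤ gridDist .eight x (toPlane z) :=
        max_le_max (by simp only [toPlane]; linarith [abs_nonneg (x.1 - c')])
          (by simp [toPlane, hx₂])

theorem mem_equidistant_of_corners {E N : Set Pixel} (hx₁ : x.1 ∈ Set.Icc (i : ℝ) (i + 1))
    (hx₂ : x.2 ∈ Set.Icc (j : ℝ) (j + 1))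
    (hc : ∀ c ∈ corners i j, c ∈ middle E N ∨ gridDist .four x (toPlane c) = 1)
    (he : ∃ e ∈ corners i j, e ∈ E) (hn : ∃ n ∈ corners i j, n ∈ N) :
    x ∈ equidistant .four E N := by
  obtain ⟨e, hec, he⟩ := he
  obtain ⟨n, hnc, hn⟩ := hn
  have hone {z : Pixel} (hz : z ∉ middle E N) : 1 ≤ gridDist .four x (toPlane z) := by
    by_cases hzc : z ∈ corners i j
    · exact ((hc z hzc).resolve_left hz).ge
    · exact one_le_gridDist_of_notMem_corners hx₁ hx₂ hzc
  have hE {z : Pixel} (hz : z ∈ E) : z ∉ middle E N := fun h => h.1 hz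
  have hN {z : Pixel} (hz : z ∈ N) : z ∉ middle E N := fun h => h.2 hz
  exact mem_equidistant_iff.2
    ⟨fun _ hz => ⟨e, he, ((hc e hec).resolve_left (hE he)).trans_le (hone (hN hz))⟩,
      fun _ hz => ⟨n, hn, ((hc n hnc).resolve_left (hN hn)).trans_le (hone (hE hz))⟩⟩

end Cell

/-! ### The boundary polygon -/

/-- The polygon spanned by a set of pixels: the union of the segments that join `β`-adjacent ones,
where `β` is the dual of `α`. -/
def polygon (α : Connectivity) (Q : Set Pixel) : Set (ℝ × ℝ) :=
  {x | ∃ u ∈ Q, ∃ v ∈ Q, PixelAdj α.dual u v ∧ x ∈ segment ℝ (toPlane u) (toPlane v)}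

theorem extPolygon_eq_polygon (α : Connectivity) (T : Set Pixel) :
    extPolygon α T = polygon α (extPerimeter α T) := by
  ext x
  refine exists_congr fun u => and_congr_right fun hu => exists_congr fun v =>
    and_congr_right fun hv => ?_
  rw [extPerimeter_adj_iff hu hv]

namespace Separation

variable {α : Connectivity} {E N : Set Pixel} {x : ℝ × ℝ} {i j : ℤ}

theorem not_adj_exterior (h : Separation α E N) : ∀ e ∈ E, ∀ n ∈ N, ¬ PixelAdj α e n :=
  fun e he n hn hen => h.not_adj n hn e he hen.symm

theorem mem_middle_of_adj (h : Separation α E N) {e n q : Pixel} (he : e ∈ E) (hn : n ∈ N)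
    (hqe : PixelAdj α q e) (hqn : PixelAdj α q n) : q ∈ middle E N :=
  ⟨fun hq => h.not_adj_exterior q hq n hn hqn, fun hq => h.not_adj q hq e he hqe⟩

theorem mem_closer_of_inner (h : Separation α E N) {n : Pixel} (hn : n ∈ N)
    (hx : gridDist α x (toPlane n) < 1) : x ∈ closer α N E :=
  mem_closer_of_lt_one h.disjoint.symm h.not_adj hn hx

theorem mem_closer_of_exterior (h : Separation α E N) {e : Pixel} (he : e ∈ E)
    (hx : gridDist α x (toPlane e) < 1) : x ∈ closer α E N :=
  mem_closer_of_lt_one h.disjoint h.not_adj_exterior he hx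

theorem mem_middle_of_lt_one (h : Separation α E N) (hx : x ∈ equidistant α E N) {z : Pixel}
    (hz : gridDist α x (toPlane z) < 1) : z ∈ middle E N :=
  ⟨fun hE => hx (Or.inr (h.mem_closer_of_exterior hE hz)),
    fun hN => hx (Or.inl (h.mem_closer_of_inner hN hz))⟩

theorem four_corner (h : Separation .four E N) {c c' d d' : ℤ} (hc : c' = c + 1 ∨ c' = c - 1)
    (hd : d' = d + 1 ∨ d' = d - 1) (h00 : (c, d) ∈ middle E N) (h10 : (c', d) ∈ middle E N) :
    (c, d') ∉ middle E N := by
  rintro ⟨hE, hN⟩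
  rcases hc with rfl | rfl
  · rcases hd with rfl | rfl <;> rcases h.four_edge h00 h10 with h' | h' <;> tauto
  · obtain ⟨c, rfl⟩ : ∃ k, c = k + 1 := ⟨c - 1, by ring⟩
    rw [add_sub_cancel_right] at h10
    rcases hd with rfl | rfl <;> rcases h.four_edge h10 h00 with h' | h' <;> tauto

theorem mem_polygon_of_opposite_corners (h : Separation .four E N) (hx : x ∈ equidistant .four E N)
    (hx₁ : x.1 ∈ Set.Icc (i : ℝ) (i + 1)) (hx₂ : x.2 ∈ Set.Icc (j : ℝ) (j + 1)) {e n : Pixel}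
    (hec : e ∈ corners i j) (he : e ∈ E) (hnc : n ∈ corners i j) (hn : n ∈ N) :
    x ∈ polygon .four (middle E N) := by
  have hne := h.disjoint.ne_of_mem he hn
  have hadj := h.not_adj_exterior e he n hn
  rw [ne_eq, Prod.ext_iff] at hne
  rw [pixelAdj_four_iff] at hadj
  obtain ⟨a, b⟩ := e
  obtain ⟨c, d⟩ := n
  obtain ⟨ha, hb⟩ := hec
  obtain ⟨hc, hd⟩ := hnc
  simp only [Set.mem_insert_iff, Set.mem_singleton_iff] at ha hb hc hd hne hadj
  have hac : a ≠ c := by omega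
  have hbd : b ≠ d := by omega
  have hu : (a, d) ∈ middle E N := h.mem_middle_of_adj he hn
    (pixelAdj_four_iff.2 (by simp only [true_and]; omega))
    (pixelAdj_four_iff.2 (by simp only [true_and]; omega))
  have hv : (c, b) ∈ middle E N := h.mem_middle_of_adj he hn
    (pixelAdj_four_iff.2 (by simp only [true_and]; omega))
    (pixelAdj_four_iff.2 (by simp only [true_and]; omega))
  refine ⟨_, hu, _, hv, pixelAdj_eight_iff.2 (by simp only; omega), ?_⟩
  obtain ⟨hx₁a, hx₁c⟩ := eq_add_abs_sub_mul hx₁ ha hc hac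
  obtain ⟨hx₂d, hx₂b⟩ := eq_add_abs_sub_mul hx₂ hd hb hbd.symm
  -- The two distances are at least `1` and add up to `2`.
  have hxe : 1 ≤ |x.1 - a| + |x.2 - b| :=
    not_lt.1 fun hlt => hx (Or.inr (h.mem_closer_of_exterior he hlt))
  have hxn : 1 ≤ |x.1 - c| + |x.2 - d| :=
    not_lt.1 fun hlt => hx (Or.inl (h.mem_closer_of_inner hn hlt))
  have hdiag : |x.1 - a| = |x.2 - d| := by linarith
  refine mem_segment_toPlane.2 ⟨|x.1 - a|, ⟨abs_nonneg _, ?_⟩, hx₁a, hdiag ▸ hx₂d⟩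
  exact abs_sub_endpoint_le_one hx₁ ha

theorem mem_polygon_of_cell (h : Separation α E N) (hx : x ∈ equidistant α E N)
    (hx₁ : x.1 ∈ Set.Ioo (i : ℝ) (i + 1)) (hx₂ : x.2 ∈ Set.Ioo (j : ℝ) (j + 1)) :
    x ∈ polygon α (middle E N) := by
  cases α with
  | four =>
    have hcomm : middle N E = middle E N := Set.ext fun _ => and_comm
    obtain ⟨e, hec, he⟩ := exists_corner_mem_of_notMem_closer hx₁ hx₂ (fun hN => hx (Or.inl hN))
      fun c c' d d' hc hd => hcomm ▸ h.four_corner hc hd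
    obtain ⟨n, hnc, hn⟩ := exists_corner_mem_of_notMem_closer hx₁ hx₂ (fun hE => hx (Or.inr hE))
      fun c c' d d' hc hd => h.four_corner hc hd
    exact h.mem_polygon_of_opposite_corners hx (Set.Ioo_subset_Icc_self hx₁)
      (Set.Ioo_subset_Icc_self hx₂) hec he hnc hn
  | eight =>
    obtain ⟨h₁, h₁'⟩ := hx₁
    obtain ⟨h₂, h₂'⟩ := hx₂
    have hi : |x.1 - i| < 1 := abs_lt.2 ⟨by linarith, by linarith⟩
    have hi' : |x.1 - (i + 1 : ℤ)| < 1 := by push_cast; exact abs_lt.2 ⟨by linarith, by linarith⟩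
    have hj : |x.2 - j| < 1 := abs_lt.2 ⟨by linarith, by linarith⟩
    have hj' : |x.2 - (j + 1 : ℤ)| < 1 := by push_cast; exact abs_lt.2 ⟨by linarith, by linarith⟩
    have hmem {c d : ℤ} (hc : |x.1 - c| < 1) (hd : |x.2 - d| < 1) : (c, d) ∈ middle E N :=
      h.mem_middle_of_lt_one hx (max_lt hc hd)
    exact absurd (hmem hi' hj') (h.eight_cell (hmem hi hj) (hmem hi' hj) (hmem hi hj'))

theorem mem_polygon_of_vertical_edge (h : Separation α E N) (hx : x ∈ equidistant α E N)
    (hx₁ : x.1 = i) (hx₂ : x.2 ∈ Set.Ioo (j : ℝ) (j + 1)) : x ∈ polygon α (middle E N) := by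
  obtain ⟨h₂, h₂'⟩ := hx₂
  have hu : (i, j) ∈ middle E N := h.mem_middle_of_lt_one hx <| by
    rw [gridDist_of_fst_eq α hx₁, toPlane, abs_lt]
    constructor <;> linarith
  have hv : (i, j + 1) ∈ middle E N := h.mem_middle_of_lt_one hx <| by
    rw [gridDist_of_fst_eq α hx₁, toPlane, abs_lt]
    push_cast
    constructor <;> linarith
  refine ⟨_, hu, _, hv, PixelAdj.of_four (pixelAdj_four_iff.2 (by simp)), ?_⟩
  exact mem_segment_toPlane.2 ⟨x.2 - j, ⟨by linarith, by linarith⟩, by simp [hx₁], by simp⟩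

theorem mem_polygon_of_horizontal_edge (h : Separation α E N) (hx : x ∈ equidistant α E N)
    (hx₁ : x.1 ∈ Set.Ioo (i : ℝ) (i + 1)) (hx₂ : x.2 = j) : x ∈ polygon α (middle E N) := by
  obtain ⟨h₁, h₁'⟩ := hx₁
  have hu : (i, j) ∈ middle E N := h.mem_middle_of_lt_one hx <| by
    rw [gridDist_of_snd_eq α hx₂, toPlane, abs_lt]
    constructor <;> linarith
  have hv : (i + 1, j) ∈ middle E N := h.mem_middle_of_lt_one hx <| by
    rw [gridDist_of_snd_eq α hx₂, toPlane, abs_lt]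
    push_cast
    constructor <;> linarith
  refine ⟨_, hu, _, hv, PixelAdj.of_four (pixelAdj_four_iff.2 (by simp)), ?_⟩
  exact mem_segment_toPlane.2 ⟨x.1 - i, ⟨by linarith, by linarith⟩, by simp, by simp [hx₂]⟩

theorem equidistant_subset_polygon (h : Separation α E N) :
    equidistant α E N ⊆ polygon α (middle E N) := by
  intro x hx
  rcases (Int.floor_le x.1).eq_or_lt with hx₁ | hx₁ <;>
    rcases (Int.floor_le x.2).eq_or_lt with hx₂ | hx₂
  · have hxz : toPlane (⌊x.1⌋, ⌊x.2⌋) = x := Prod.ext hx₁ hx₂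
    have hq := h.mem_middle_of_lt_one hx (z := (⌊x.1⌋, ⌊x.2⌋))
      (by rw [hxz, gridDist_self]; exact one_pos)
    obtain ⟨q', hq', hadj⟩ := h.exists_middle_adj hq
    exact ⟨_, hq, q', hq', hadj, Set.mem_of_eq_of_mem hxz.symm (left_mem_segment ℝ _ _)⟩
  · exact h.mem_polygon_of_vertical_edge hx hx₁.symm ⟨hx₂, Int.lt_floor_add_one _⟩
  · exact h.mem_polygon_of_horizontal_edge hx ⟨hx₁, Int.lt_floor_add_one _⟩ hx₂.symm
  · exact h.mem_polygon_of_cell hx ⟨hx₁, Int.lt_floor_add_one _⟩ ⟨hx₂, Int.lt_floor_add_one _⟩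

theorem four_equidistant_of_edge (h : Separation .four E N) (hu : (i, j) ∈ middle E N)
    (hv : (i + 1, j) ∈ middle E N) (hx₁ : x.1 ∈ Set.Icc (i : ℝ) (i + 1)) (hx₂ : x.2 = j) :
    x ∈ equidistant .four E N := by
  obtain ⟨k, l, hk, hl, hkN, hlE⟩ : ∃ k l, (k = j + 1 ∨ k = j - 1) ∧ (l = j + 1 ∨ l = j - 1) ∧
      (∀ c ∈ ({i, i + 1} : Set ℤ), (c, k) ∈ N) ∧ ∀ c ∈ ({i, i + 1} : Set ℤ), (c, l) ∈ E := by
    rcases h.four_edge hu hv with ⟨hN, hE⟩ | ⟨hE, hN⟩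
    · exact ⟨j + 1, j - 1, by simp, by simp, by simpa using hN, by simpa using hE⟩
    · exact ⟨j - 1, j + 1, by simp, by simp, by simpa using hN, by simpa using hE⟩
  refine mem_equidistant_iff.2 ⟨fun n hn => ?_, fun e he => ?_⟩
  · obtain ⟨c, hc, hcn⟩ := exists_endpoint_gridDist_four_le hx₁ hx₂ (z := n)
      (ne_of_mem_of_not_mem hn hu.2) (ne_of_mem_of_not_mem hn hv.2)
    exact ⟨(c, l), hlE c hc, hcn l hl⟩
  · obtain ⟨c, hc, hce⟩ := exists_endpoint_gridDist_four_le hx₁ hx₂ (z := e)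
      (ne_of_mem_of_not_mem he hu.1) (ne_of_mem_of_not_mem he hv.1)
    exact ⟨(c, k), hkN c hc, hce k hk⟩

theorem eight_equidistant_of_edge (h : Separation .eight E N) (hu : (i, j) ∈ middle E N)
    (hv : (i + 1, j) ∈ middle E N) (hx₁ : x.1 ∈ Set.Icc (i : ℝ) (i + 1)) (hx₂ : x.2 = j) :
    x ∈ equidistant .eight E N := by
  obtain ⟨k, l, hk, hl, ⟨c, hc, hcN⟩, d, hd, hdE⟩ : ∃ k l, (k = j + 1 ∨ k = j - 1) ∧
      (l = j + 1 ∨ l = j - 1) ∧ (∃ c ∈ ({i, i + 1} : Set ℤ), (c, k) ∈ N) ∧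
        ∃ d ∈ ({i, i + 1} : Set ℤ), (d, l) ∈ E := by
    rcases h.eight_edge hu hv with ⟨hE, hN⟩ | ⟨hN, hE⟩
    · exact ⟨j - 1, j + 1, by simp, by simp, by simpa using hN, by simpa using hE⟩
    · exact ⟨j + 1, j - 1, by simp, by simp, by simpa using hN, by simpa using hE⟩
  refine mem_equidistant_iff.2 ⟨fun n hn => ⟨_, hdE, ?_⟩, fun e he => ⟨_, hcN, ?_⟩⟩
  · exact gridDist_eight_le_of_edge hx₁ hx₂ (ne_of_mem_of_not_mem hn hu.2)
      (ne_of_mem_of_not_mem hn hv.2) hd hl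
  · exact gridDist_eight_le_of_edge hx₁ hx₂ (ne_of_mem_of_not_mem he hu.1)
      (ne_of_mem_of_not_mem he hv.1) hc hk

theorem equidistant_of_edge (h : Separation α E N) (hu : (i, j) ∈ middle E N)
    (hv : (i + 1, j) ∈ middle E N) (hx₁ : x.1 ∈ Set.Icc (i : ℝ) (i + 1)) (hx₂ : x.2 = j) :
    x ∈ equidistant α E N := by
  cases α
  · exact h.four_equidistant_of_edge hu hv hx₁ hx₂
  · exact h.eight_equidistant_of_edge hu hv hx₁ hx₂

theorem equidistant_of_vertical_edge (h : Separation α E N) (hu : (i, j) ∈ middle E N)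
    (hv : (i, j + 1) ∈ middle E N) (hx₁ : x.1 = i) (hx₂ : x.2 ∈ Set.Icc (j : ℝ) (j + 1)) :
    x ∈ equidistant α E N := fun hx =>
  h.swap.equidistant_of_edge (x := x.swap) (i := j) (j := i) hu hv hx₂ hx₁
    (hx.imp swap_mem_closer swap_mem_closer)

theorem four_equidistant_of_diag (h : Separation .four E N) (hu : (i, j) ∈ middle E N)
    (hv : (i + 1, j + 1) ∈ middle E N) (hx₁ : x.1 ∈ Set.Icc (i : ℝ) (i + 1))
    (hx : x.1 - i = x.2 - j) : x ∈ equidistant .four E N := by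
  obtain ⟨h₁, h₁'⟩ := hx₁
  refine mem_equidistant_of_corners (i := i) (j := j) ⟨h₁, h₁'⟩ ⟨by linarith, by linarith⟩ ?_ ?_ ?_
  · rintro ⟨a, b⟩ ⟨rfl | rfl, rfl | rfl⟩
    · exact Or.inl hu
    · right
      simp only [gridDist, toPlane, Int.cast_add, Int.cast_one]
      rw [abs_of_nonneg (by linarith), abs_of_nonpos (by linarith)]
      linarith
    · right
      simp only [gridDist, toPlane, Int.cast_add, Int.cast_one]
      rw [abs_of_nonpos (by linarith), abs_of_nonneg (by linarith)]
      linarith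
    · exact Or.inl hv
  · rcases h.four_diag hu hv with ⟨he, -⟩ | ⟨-, he⟩ <;> exact ⟨_, by simp [corners], he⟩
  · rcases h.four_diag hu hv with ⟨-, hn⟩ | ⟨hn, -⟩ <;> exact ⟨_, by simp [corners], hn⟩

theorem four_equidistant_of_antidiag (h : Separation .four E N) (hu : (i + 1, j) ∈ middle E N)
    (hv : (i, j + 1) ∈ middle E N) (hx₁ : x.1 ∈ Set.Icc (i : ℝ) (i + 1))
    (hx : i + 1 - x.1 = x.2 - j) : x ∈ equidistant .four E N := by
  obtain ⟨h₁, h₁'⟩ := hx₁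
  refine mem_equidistant_of_corners (i := i) (j := j) ⟨h₁, h₁'⟩ ⟨by linarith, by linarith⟩ ?_ ?_ ?_
  · rintro ⟨a, b⟩ ⟨rfl | rfl, rfl | rfl⟩
    · right
      simp only [gridDist, toPlane]
      rw [abs_of_nonneg (by linarith), abs_of_nonneg (by linarith)]
      linarith
    · exact Or.inl hv
    · exact Or.inl hu
    · right
      simp only [gridDist, toPlane, Int.cast_add, Int.cast_one]
      rw [abs_of_nonpos (by linarith), abs_of_nonpos (by linarith)]
      linarith
  · rcases h.four_antidiag hu hv with ⟨he, -⟩ | ⟨-, he⟩ <;> exact ⟨_, by simp [corners], he⟩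
  · rcases h.four_antidiag hu hv with ⟨-, hn⟩ | ⟨hn, -⟩ <;> exact ⟨_, by simp [corners], hn⟩

theorem segment_subset_equidistant (h : Separation α E N) {u v : Pixel} (hu : u ∈ middle E N)
    (hv : v ∈ middle E N) (hadj : PixelAdj α.dual u v)
    (hlt : u.2 < v.2 ∨ u.2 = v.2 ∧ u.1 < v.1) :
    segment ℝ (toPlane u) (toPlane v) ⊆ equidistant α E N := by
  obtain ⟨i, j⟩ := u
  obtain ⟨k, l⟩ := v
  have hcase : (l = j ∧ k = i + 1) ∨ (l = j + 1 ∧ k = i) ∨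
      (α = .four ∧ l = j + 1 ∧ (k = i + 1 ∨ i = k + 1)) := by
    cases α with
    | four =>
      have := pixelAdj_eight_iff.1 hadj
      simp only [true_and] at this hlt ⊢
      omega
    | eight =>
      have := pixelAdj_four_iff.1 hadj
      simp only at this hlt
      omega
  intro x hx
  obtain ⟨t, ⟨h0, h1⟩, hx₁, hx₂⟩ := mem_segment_toPlane.1 hx
  rcases hcase with ⟨rfl, rfl⟩ | ⟨rfl, rfl⟩ | ⟨rfl, rfl, rfl | rfl⟩ <;> push_cast at hx₁ hx₂
  · exact h.equidistant_of_edge hu hv ⟨by linarith, by linarith⟩ (by linarith)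
  · exact h.equidistant_of_vertical_edge hu hv (by linarith) ⟨by linarith, by linarith⟩
  · exact h.four_equidistant_of_diag hu hv ⟨by linarith, by linarith⟩ (by linarith)
  · exact h.four_equidistant_of_antidiag hu hv ⟨by linarith, by linarith⟩ (by linarith)

theorem polygon_eq_equidistant (h : Separation α E N) :
    polygon α (middle E N) = equidistant α E N := by
  refine Set.Subset.antisymm ?_ h.equidistant_subset_polygon
  rintro x ⟨u, hu, v, hv, hadj, hx⟩
  have hne := hadj.ne
  rw [ne_eq, Prod.ext_iff] at hne
  have hlex : (u.2 < v.2 ∨ u.2 = v.2 ∧ u.1 < v.1) ∨ (v.2 < u.2 ∨ v.2 = u.2 ∧ v.1 < u.1) := by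
    omega
  rcases hlex with hlt | hlt
  · exact h.segment_subset_equidistant hu hv hadj hlt hx
  · rw [segment_symm] at hx
    exact h.segment_subset_equidistant hv hu hadj.symm hlt hx

theorem isBounded_connectedComponentIn_iff (h : Separation α E N) (hE : E.Infinite)
    (hEc : Eᶜ.Finite) (hN : N.Nonempty) (hx : x ∉ polygon α (middle E N)) :
    Bornology.IsBounded (connectedComponentIn (polygon α (middle E N))ᶜ x) ↔
      x ∈ closer α N E := by
  have hcompl : (polygon α (middle E N))ᶜ = closer α N E ∪ closer α E N := by
    rw [h.polygon_eq_equidistant, equidistant, compl_compl]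
  rw [← Set.mem_compl_iff] at hx
  constructor
  · intro hb
    refine (hcompl ▸ hx).resolve_right fun hxE =>
      not_isBounded_closer h.disjoint h.not_adj_exterior hE (hb.subset ?_)
    have hconn := isPathConnected_closer h.disjoint h.not_adj_exterior hE.nonempty h.connected
    exact hconn.isConnected.isPreconnected.subset_connectedComponentIn hxE
      (hcompl ▸ Set.subset_union_right)
  · intro hxN
    refine (isBounded_closer (α := α) h.disjoint.symm hEc).subset ?_
    exact isPreconnected_connectedComponentIn.subset_left_of_subset_union
      (isOpen_closer α N hE.nonempty) (isOpen_closer α E hN) (disjoint_closer α N E)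
      (hcompl ▸ connectedComponentIn_subset _ _) ⟨x, mem_connectedComponentIn hx, hxN⟩

theorem toPlane_mem_closer_iff (h : Separation α E N) {z : Pixel} :
    toPlane z ∈ closer α N E ↔ z ∈ N := by
  constructor
  · rintro ⟨n, hn, hlt⟩
    by_contra hz
    by_cases hzE : z ∈ E
    · have := hlt z hzE
      rw [gridDist_self] at this
      exact this.not_ge (gridDist_nonneg _ _ _)
    · obtain ⟨e, he, hze⟩ := h.exists_exterior z ⟨hzE, hz⟩
      have := hlt e he
      rw [hze] at this
      exact this.not_ge (one_le_gridDist (ne_of_mem_of_not_mem hn hz).symm)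
  · exact fun hz => h.mem_closer_of_inner hz (by rw [gridDist_self]; exact one_pos)

end Separation

theorem IsComponent.region_eq {α : Connectivity} {T : Set Pixel} (hT : IsComponent α T) :
    region α T = closer α (inner α T) (exterior α T) := by
  have h := hT.separation
  obtain ⟨t, ht⟩ := Set.nonempty_coe_sort.1 hT.2.nonempty
  have hpoly : extPolygon α T = polygon α (middle (exterior α T) (inner α T)) := by
    rw [middle_inner hT.1, extPolygon_eq_polygon]
  ext x
  rw [region, hpoly]
  have hx := h.isBounded_connectedComponentIn_iff (x := x) (exterior_infinite hT.1)
    (exterior_compl_finite hT.1) ⟨t, subset_inner hT.1 ht⟩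
  refine ⟨fun hr => (hx hr.1).1 hr.2, fun hc => ?_⟩
  have hxp : x ∉ polygon α (middle (exterior α T) (inner α T)) := by
    rw [h.polygon_eq_equidistant]
    exact fun he => he (Or.inl hc)
  exact ⟨hxp, (hx hxp).2 hc⟩

theorem IsComponent.interiorPixels_eq {α : Connectivity} {T : Set Pixel} (hT : IsComponent α T) :
    interiorPixels α T = inner α T := by
  ext z
  rw [interiorPixels, hT.region_eq]
  exact hT.separation.toPlane_mem_closer_iff

end DigitalImage

theorem lemma6p1 (α : DigitalImage.Connectivity) (T : Set DigitalImage.Pixel)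
    (hT : DigitalImage.IsComponent α T) :
    DigitalImage.region α T =
      {x : ℝ × ℝ | DigitalImage.distTo α x (DigitalImage.interiorPixels α T) <
        DigitalImage.distTo α x (DigitalImage.exterior α T)} := by
  ext x
  rw [hT.region_eq, hT.interiorPixels_eq]
  exact DigitalImage.distTo_lt_distTo_iff.symm
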